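/- **Setting.** Let $A\in\mathbb R^{J\times K}$ have rank $J$. One observation $O$ has law $P$ on $\mathcal O$ and includes covariates $X=X(O)\in\mathcal X$; $O_1,O_2,\dots$ are iid copies of $O$ and $X_i=X(O_i)$. Let $b:\mathcal X\to\mathbb R^J$ and $c:\mathcal X\to\mathbb R^K$ be bounded measurable functions such that, for every $x$, the feasible set $\mathcal P(x)=\{p\in\mathbb R^K: p\ge 0,\ Ap=b(x)\}$ is non-empty and bounded. Put $\theta_L=\mathbb E[\min_{p\in\mathcal P(X)}\langle c(X),p\rangle]$. For a set $B$ of $J$ distinct column indices with $A_B$ (the submatrix of these columns) invertible, let $A_B^{-1}$ also denote the $K\times J$ matrix whose rows indexed by $B$ are those of the inverse and whose other rows are $0$. Let $\mathcal B(x)$ be the set of bases of the basic feasible solutions, i.e. of those $B$ with $A_B$ invertible and $A_B^{-1}b(x)\ge 0$, and let $\mathcal B^*_L(x)=\operatorname{argmin}_{B\in\mathcal B(x)}\langle c(x),A_B^{-1}b(x)\rangle$. Let $\Delta_L(x)$ be the minimum of $\langle c(x),A_B^{-1}b(x)\rangle$ over $B\in\mathcal B(x)\setminus\mathcal B_L^*(x)$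 minus the optimal value, with $\Delta_L(x)=0$ if $\mathcal B(x)=\mathcal B^*_L(x)$. For $f:\mathcal X\to\mathbb R^m$ write $\|f\|_\infty=\max_i\sup_x|f_i(x)|$ and $\|f\|_2^2=\sum_i\mathbb E[f_i(X)^2]$. **Estimates.** For each $n$, estimates $\hat b,\hat c$ (functions on $\mathcal X$) and $\hat\varphi^{(b)},\hat\varphi^{(c)}$ (functions on $\mathcal O$) are fit on a separate sample independent of $(O_1,\dots,O_n)$. The estimated basis is a measurable choice of $\hat B_L(x)\in\operatorname{argmin}_{B\in\mathcal B(x)}\langle\hat c(x),A_B^{-1}\hat b(x)\rangle$, where the minimum is over the same set of bases $\mathcal B(x)$ as in the definition of $\mathcal B_L^*(x)$. The de-biased BFS estimator is $$\hat\theta_L=\frac1n\sum_{i=1}^n\Big\langle\hat c(X_i)+\hat\varphi^{(c)}(O_i),A_{\hat B_L(X_i)}^{-1}\hat b(X_i)\Big\rangle+\Big\langle\hat c(X_i),A^{-1}_{\hat B_L(X_i)}\hat\varphi^{(b)}(O_i)\Big\rangle .$$ **Assumptions.** 1. (De-biasing functions.) There are functions $\varphi^{(b)}(O;\bar b)\in\mathbb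 R^J$ such that, for every $j$, $\mathbb E[\varphi^{(b)}_j(O;b)\mid X]=0$, $\mathbb E[\varphi_j^{(b)}(O;b)^2]<\infty$, and $\mathbb E[\bar b_j(X)+\varphi^{(b)}_j(O;\bar b)\mid X]=b_j(X)$ for every bounded measurable $\bar b:\mathcal X\to\mathbb R^J$; likewise $\varphi^{(c)}(O;\bar c)\in\mathbb R^K$ for $c$. Write $\varphi^{(b)}(o)=\varphi^{(b)}(o;b)$ and $\varphi^{(c)}(o)=\varphi^{(c)}(o;c)$. 2. (Consistency and de-biased rate.) For all $j,k$: $\sup_x|\hat b_j-b_j|$, $\sup_x|\hat c_k-c_k|$, $\sup_o|\hat\varphi^{(b)}_j-\varphi^{(b)}_j|$ and $\sup_o|\hat\varphi^{(c)}_k-\varphi^{(c)}_k|$ are $o_p(1)$. There are a constant $C$ and $r_n\ge 0$ (possibly depending on the separate sample) such that, for every bounded measurable $f$, $|\mathbb E\langle f(X),\hat b(X)+\hat\varphi^{(b)}(O)-b(X)\rangle|\le C\sup_x\|f(x)\|_2\,r_n$ and $|\mathbb E\langle f(X),\hat c(X)+\hat\varphi^{(c)}(O)-c(X)\rangle|\le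 C\sup_x\|f(x)\|_2\,r_n$, the expectations being over a new observation $O$ with the estimates held fixed. 3. (Margin condition.) For some $\alpha>0$ and some constant $C'$, $P(0<\Delta_L(X)\le t)\le C't^\alpha$ for all $t>0$. 4. (Rates.) $(\|\hat b-b\|_\infty+\|\hat c-c\|_\infty)^{1+\alpha}$, $\|\hat b-b\|_2\,\|\hat c-c\|_2$ and $r_n$ are each $o_p(n^{-1/2})$. 5. (Unique optimal basis.) $\mathcal B^*_L(x)=\{B^*_L(x)\}$ for all $x\in\mathcal X$. **Conclusion.** Let $$V_L=\operatorname{Var}\Big(\big\langle c(X),A^{-1}_{B^*_L(X)}\big(b(X)+\varphi^{(b)}(O)\big)\big\rangle+\big\langle\varphi^{(c)}(O),A^{-1}_{B^*_L(X)}b(X)\big\rangle\Big)$$ and suppose $V_L>0$. Then $\sqrt n\,(\hat\theta_L-\theta_L)/\sqrt{V_L}$ converges in distribution to $N(0,1)$ as $n\to\infty$. -/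

import Mathlib

open MeasureTheory ProbabilityTheory Filter Topology Matrix
open scoped ENNReal NNReal

noncomputable section

namespace CondLP

/-! ### Linear programs in standard form and their bases -/

section LP

variable {J K : ℕ}

/-- The feasible set `{p ∈ ℝ^K | p ≥ 0, A p = b}`. -/
def feasibleSet (A : Matrix (Fin J) (Fin K) ℝ) (b : Fin J → ℝ) : Set (Fin K → ℝ) :=
  {p | (∀ k, 0 ≤ p k) ∧ A *ᵥ p = b}

/-- The minimal value of `⟨c, p⟩` over the feasible set. -/
def lpMin (A : Matrix (Fin J) (Fin K) ℝ) (b : Fin J → ℝ) (c : Fin K → ℝ) : ℝ :=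
  sInf ((fun p => c ⬝ᵥ p) '' feasibleSet A b)

/-- The sets `B = {i₁ < ... < i_J}` of `J` distinct column indices, recorded through their
increasing enumeration `j ↦ i_j`. -/
abbrev Basis (J K : ℕ) : Type := Fin J ↪o Fin K

/-- The square submatrix `A_B` of the columns of `A` in `B`. -/
def basisMatrix (A : Matrix (Fin J) (Fin K) ℝ) (B : Basis J K) : Matrix (Fin J) (Fin J) ℝ :=
  A.submatrix id B

/-- The `K × J` matrix `A_B⁻¹`, whose row `i_j` is the row `j` of the inverse of the square
matrix `A_B` and whose other rows are zero. -/
def basisInv (A : Matrix (Fin J) (Fin K) ℝ) (B : Basis J K) : Matrix (Fin K) (Fin J) ℝ :=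
  Matrix.of fun k j => ∑ i, if B i = k then (basisMatrix A B)⁻¹ i j else 0

/-- The bases of the basic feasible solutions of `{p ≥ 0, A p = b}`: `A_B` is invertible and
`A_B⁻¹ b ≥ 0`. -/
def feasibleBases (A : Matrix (Fin J) (Fin K) ℝ) (b : Fin J → ℝ) : Set (Basis J K) :=
  {B | IsUnit (basisMatrix A B).det ∧ ∀ k, 0 ≤ (basisInv A B *ᵥ b) k}

/-- The objective value `⟨c, A_B⁻¹ b⟩`. -/
def basisValue (A : Matrix (Fin J) (Fin K) ℝ) (b : Fin J → ℝ) (c : Fin K → ℝ)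
    (B : Basis J K) : ℝ :=
  c ⬝ᵥ (basisInv A B *ᵥ b)

/-- `argmin_{B ∈ S} ⟨c, A_B⁻¹ b⟩`. -/
def argminBases (S : Set (Basis J K)) (A : Matrix (Fin J) (Fin K) ℝ) (b : Fin J → ℝ)
    (c : Fin K → ℝ) : Set (Basis J K) :=
  {B | B ∈ S ∧ ∀ B' ∈ S, basisValue A b c B ≤ basisValue A b c B'}

/-- The set of optimal bases of the minimization problem. -/
def optimalBases (A : Matrix (Fin J) (Fin K) ℝ) (b : Fin J → ℝ) (c : Fin K → ℝ) :
    Set (Basis J K) :=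
  argminBases (feasibleBases A b) A b c

/-- The sub-optimality gap: the least difference between the value at a non-optimal feasible
basis and the optimal value. It is `0` if every feasible basis is optimal (`sInf ∅ = 0`). -/
def subOptGap (A : Matrix (Fin J) (Fin K) ℝ) (b : Fin J → ℝ) (c : Fin K → ℝ) : ℝ :=
  sInf {d | ∃ B ∈ feasibleBases A b \ optimalBases A b c, ∃ B' ∈ optimalBases A b c,
    d = basisValue A b c B - basisValue A b c B'}

/-- The summand of the de-biased estimator,
`⟨c + φc, A_B⁻¹ b⟩ + ⟨c, A_B⁻¹ φb⟩`. -/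
def debiasedTerm (A : Matrix (Fin J) (Fin K) ℝ) (B : Basis J K) (b φb : Fin J → ℝ)
    (c φc : Fin K → ℝ) : ℝ :=
  (c + φc) ⬝ᵥ (basisInv A B *ᵥ b) + c ⬝ᵥ (basisInv A B *ᵥ φb)

/-- The variable whose variance is the asymptotic variance,
`⟨c, A_B⁻¹ (b + φb)⟩ + ⟨φc, A_B⁻¹ b⟩`. -/
def varianceTerm (A : Matrix (Fin J) (Fin K) ℝ) (B : Basis J K) (b φb : Fin J → ℝ)
    (c φc : Fin K → ℝ) : ℝ :=
  c ⬝ᵥ (basisInv A B *ᵥ (b + φb)) + φc ⬝ᵥ (basisInv A B *ᵥ b)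

end LP

/-! ### Norms and stochastic orders -/

/-- `‖f‖_∞ = max_i sup_x |f_i(x)|`, possibly infinite. -/
def supNorm {S ι : Type*} (f : S → ι → ℝ) : ℝ≥0∞ :=
  ⨆ i, ⨆ x, ‖f x i‖ₑ

/-- `‖f‖_2 = (∑_i E[f_i(X)²])^{1/2}`, possibly infinite; `P` is the law of the observation and
`X` the covariate map. -/
def l2Norm {𝒪 𝒳 ι : Type*} [MeasurableSpace 𝒪] [Fintype ι] (P : Measure 𝒪) (X : 𝒪 → 𝒳)
    (f : 𝒳 → ι → ℝ) : ℝ≥0∞ :=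
  (∑ i, ∫⁻ o, ‖f (X o) i‖ₑ ^ 2 ∂P) ^ (1 / 2 : ℝ)

/-- `Y_n = o_p(a_n)` for `Y_n ≥ 0`: for each `ε > 0`, the (outer) probability of
`Y_n > ε a_n` tends to zero. -/
def IsLittleOp {Ω : Type*} [MeasurableSpace Ω] (μ : Measure Ω) (Y : ℕ → Ω → ℝ≥0∞)
    (a : ℕ → ℝ) : Prop :=
  ∀ ε : ℝ, 0 < ε → Tendsto (fun n => μ {ω | ENNReal.ofReal (ε * a n) < Y n ω}) atTop (𝓝 0)

/-! ### Assumptions on the nuisance functions and their estimates -/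

/-- `φ` is a de-biasing function for `g`: `φ g' o` is `φ(o; g')`, for an arbitrary function `g'`
in place of the true `g`. -/
structure IsDebiasing {𝒪 𝒳 ι : Type*} [MeasurableSpace 𝒪] [MeasurableSpace 𝒳]
    (P : Measure 𝒪) (X : 𝒪 → 𝒳) (g : 𝒳 → ι → ℝ) (φ : (𝒳 → ι → ℝ) → 𝒪 → ι → ℝ) : Prop where
  /-- `E[φ_i(O; g)²] < ∞` -/
  memLp : ∀ i, MemLp (fun o => φ g o i) 2 P
  /-- `E[φ_i(O; g) | X] = 0` -/
  condExp_eq_zero : ∀ i,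
    P[fun o => φ g o i | MeasurableSpace.comap X inferInstance] =ᵐ[P] fun _ => 0
  /-- `E[g'_i(X) + φ_i(O; g') | X] = g_i(X)` for every bounded `g'` -/
  condExp_debiased : ∀ g' : 𝒳 → ι → ℝ, Measurable g' → supNorm g' < ∞ → ∀ i,
    Integrable (fun o => g' (X o) i + φ g' o i) P ∧
    P[fun o => g' (X o) i + φ g' o i | MeasurableSpace.comap X inferInstance]
      =ᵐ[P] fun o => g (X o) i

/-- For every bounded `f`, `|E⟨f(X), ĝ(X) + φ̂(O) - g(X)⟩| ≤ C sup_x ‖f(x)‖₂ r`; the expectation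
is over `O`, with the estimates `ĝ` and `φ̂` held fixed. -/
def DebiasedRate {𝒪 𝒳 ι : Type*} [MeasurableSpace 𝒪] [MeasurableSpace 𝒳] [Fintype ι]
    (P : Measure 𝒪) (X : 𝒪 → 𝒳) (g ghat : 𝒳 → ι → ℝ) (φhat : 𝒪 → ι → ℝ)
    (C : ℝ≥0) (r : ℝ≥0∞) : Prop :=
  ∀ f : 𝒳 → ι → ℝ, Measurable f → supNorm f < ∞ →
    ‖∫ o, f (X o) ⬝ᵥ (ghat (X o) + φhat o - g (X o)) ∂P‖ₑ
      ≤ C * (⨆ x, ‖WithLp.toLp 2 (f x)‖ₑ) * r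

end CondLP

end

open CondLP

noncomputable section

namespace CondLP

section LP
variable {J K : ℕ}

theorem basisInv_mulVec_apply (A : Matrix (Fin J) (Fin K) ℝ) (B : Basis J K) (b : Fin J → ℝ)
    (k : Fin K) :
    (basisInv A B *ᵥ b) k = ∑ i, if B i = k then ((basisMatrix A B)⁻¹ *ᵥ b) i else 0 := by
  simp only [basisInv, Matrix.mulVec, dotProduct, Matrix.of_apply, Finset.sum_mul]
  rw [Finset.sum_comm]
  refine Finset.sum_congr rfl fun i _ => ?_
  split_ifs <;> simp

theorem mulVec_eq_basisMatrix_mulVec (A : Matrix (Fin J) (Fin K) ℝ) (B : Basis J K)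
    {p : Fin K → ℝ} (hp : ∀ k, k ∉ Set.range B → p k = 0) :
    A *ᵥ p = basisMatrix A B *ᵥ (p ∘ B) := by
  ext j
  simp only [Matrix.mulVec, dotProduct, basisMatrix, Matrix.submatrix_apply, id, Function.comp]
  rw [← Finset.sum_image (s := Finset.univ) (g := B) (f := fun k => A j k * p k)
    (fun x _ y _ h => B.injective h)]
  symm
  refine Finset.sum_subset (Finset.subset_univ _) fun k _ hk => ?_
  rw [hp k (by simpa using hk), mul_zero]

theorem basisInv_mulVec_eq {A : Matrix (Fin J) (Fin K) ℝ} {B : Basis J K}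
    (hB : IsUnit (basisMatrix A B).det) {p : Fin K → ℝ} (hp : ∀ k, k ∉ Set.range B → p k = 0) :
    basisInv A B *ᵥ (A *ᵥ p) = p := by
  ext k
  rw [basisInv_mulVec_apply, mulVec_eq_basisMatrix_mulVec A B hp, Matrix.mulVec_mulVec,
    Matrix.nonsing_inv_mul _ hB, Matrix.one_mulVec]
  by_cases hk : k ∈ Set.range B
  · obtain ⟨i, rfl⟩ := hk
    simp
  · rw [hp k hk]
    refine Finset.sum_eq_zero fun i _ => if_neg fun h => hk ⟨i, h⟩

theorem basisInv_mulVec_mem_feasibleSet {A : Matrix (Fin J) (Fin K) ℝ} {b : Fin J → ℝ}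
    {B : Basis J K} (hB : B ∈ feasibleBases A b) : basisInv A B *ᵥ b ∈ feasibleSet A b := by
  refine ⟨hB.2, ?_⟩
  rw [mulVec_eq_basisMatrix_mulVec A B]
  · have : (basisInv A B *ᵥ b) ∘ B = (basisMatrix A B)⁻¹ *ᵥ b := by
      ext i
      simp [basisInv_mulVec_apply]
    rw [this, Matrix.mulVec_mulVec, Matrix.mul_nonsing_inv _ hB.1, Matrix.one_mulVec]
  · intro k hk
    rw [basisInv_mulVec_apply]
    exact Finset.sum_eq_zero fun i _ => if_neg fun h => hk ⟨i, h⟩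

/-- Linearly independent columns of a matrix of full row rank can be extended to a basis. -/
theorem exists_basis_of_linearIndepOn {A : Matrix (Fin J) (Fin K) ℝ} (hA : A.rank = J)
    {s : Set (Fin K)} (hs : LinearIndepOn ℝ A.col s) :
    ∃ B : Basis J K, IsUnit (basisMatrix A B).det ∧ s ⊆ Set.range B := by
  classical
  obtain ⟨t, -, hst, hspan, ht⟩ := exists_linearIndepOn_extension hs (Set.subset_univ s)
  have hcard : t.toFinset.card = J := by
    have h1 : Submodule.span ℝ (A.col '' t) = Submodule.span ℝ (Set.range A.col) := by
      refine le_antisymm (Submodule.span_mono (Set.image_subset_range _ _)) ?_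
      rw [← Set.image_univ]
      exact Submodule.span_le.2 hspan
    have h2 := finrank_span_eq_card ht
    rw [← Set.image_eq_range, h1, ← Matrix.rank_eq_finrank_span_cols, hA] at h2
    rw [h2, Set.toFinset_card]
  refine ⟨t.toFinset.orderEmbOfFin hcard, ?_, ?_⟩
  · rw [← Matrix.isUnit_iff_isUnit_det, ← Matrix.linearIndependent_cols_iff_isUnit]
    have : (basisMatrix A (t.toFinset.orderEmbOfFin hcard)).col
        = (fun k : t => A.col k) ∘ fun i => ⟨t.toFinset.orderEmbOfFin hcard i,
          Set.mem_toFinset.1 (t.toFinset.orderEmbOfFin_mem hcard i)⟩ := rfl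
    rw [this]
    refine ht.comp _ fun i j hij => ?_
    simpa using hij
  · rw [Finset.range_orderEmbOfFin]
    simpa using hst

/-- In a bounded feasible set every point is dominated by a basic feasible solution. -/
theorem exists_feasibleBasis_le {A : Matrix (Fin J) (Fin K) ℝ} (hA : A.rank = J)
    {b : Fin J → ℝ} (hbd : Bornology.IsBounded (feasibleSet A b)) (c : Fin K → ℝ) (m : ℕ) :
    ∀ p ∈ feasibleSet A b, (Finset.univ.filter fun k => p k ≠ 0).card ≤ m →
      ∃ B ∈ feasibleBases A b, basisValue A b c B ≤ c ⬝ᵥ p := by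
  classical
  induction m with
  | zero => ?_
  | succ m ih => ?_
  all_goals
    intro p hp hm
    by_cases hli : LinearIndepOn ℝ A.col {k | p k ≠ 0}
    · obtain ⟨B, hB, hsB⟩ := exists_basis_of_linearIndepOn hA hli
      have h := basisInv_mulVec_eq hB (p := p) fun k hk => by
        by_contra h
        exact hk (hsB h)
      rw [hp.2] at h
      exact ⟨B, ⟨hB, by rw [h]; exact hp.1⟩, by rw [basisValue, h]⟩
  · exfalso
    refine hli ?_
    have : {k | p k ≠ 0} = ∅ := by
      ext k
      have := Finset.card_eq_zero.1 (Nat.le_zero.1 hm)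
      rw [Finset.filter_eq_empty_iff] at this
      simpa using this (Finset.mem_univ k)
    rw [this]
    exact linearIndepOn_empty _ _
  · -- a direction in the kernel that does not increase the objective
    obtain ⟨d, hd0, hdA, hdp, hdc⟩ : ∃ d : Fin K → ℝ, d ≠ 0 ∧ A *ᵥ d = 0 ∧
        (∀ k, p k = 0 → d k = 0) ∧ c ⬝ᵥ d ≤ 0 := by
      obtain ⟨d, hd0, hdA, hdp⟩ : ∃ d : Fin K → ℝ, d ≠ 0 ∧ A *ᵥ d = 0 ∧
          (∀ k, p k = 0 → d k = 0) := by
        rw [linearIndepOn_iff'] at hli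
        push Not at hli
        obtain ⟨s, g, hsp, hsum, i, his, hgi⟩ := hli
        refine ⟨fun k => if k ∈ s then g k else 0, fun h => hgi ?_, ?_, fun k hk => ?_⟩
        · simpa [his] using congrFun h i
        · ext j
          have := congrFun hsum j
          simpa [Matrix.mulVec, dotProduct, Finset.sum_apply, mul_comm] using this
        · exact if_neg fun h => hsp h hk
      rcases le_total (c ⬝ᵥ d) 0 with h | h
      · exact ⟨d, hd0, hdA, hdp, h⟩
      · exact ⟨-d, by simpa using hd0, by rw [Matrix.mulVec_neg, hdA, neg_zero],
          fun k hk => by simp [hdp k hk], by rw [dotProduct_neg]; linarith⟩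
    have hmove : ∀ t : ℝ, (∀ k, 0 ≤ p k + t * d k) → p + t • d ∈ feasibleSet A b := fun t ht =>
      ⟨ht, by rw [Matrix.mulVec_add, Matrix.mulVec_smul, hdA, hp.2, smul_zero, add_zero]⟩
    have hneg : ∃ k, d k < 0 := by
      by_contra! hcon
      obtain ⟨k, hk⟩ := Function.ne_iff.1 hd0
      have hk' : 0 < d k := lt_of_le_of_ne (hcon k) (Ne.symm hk)
      obtain ⟨R, hR⟩ := hbd.exists_norm_le
      have hR0 : 0 ≤ R := (norm_nonneg _).trans (hR p hp)
      have h1 := hR _ (hmove ((R + 1) / d k) fun i => add_nonneg (hp.1 i)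
        (mul_nonneg (by positivity) (hcon i)))
      have h2 := (Real.le_norm_self _).trans ((norm_le_pi_norm _ k).trans h1)
      simp only [Pi.add_apply, Pi.smul_apply, smul_eq_mul] at h2
      rw [div_mul_cancel₀ _ hk'.ne'] at h2
      linarith [hp.1 k]
    obtain ⟨k₀, hk₀⟩ := hneg
    obtain ⟨k, hk, hmin⟩ := Finset.exists_min_image (Finset.univ.filter fun k => d k < 0)
      (fun k => p k / -d k) ⟨k₀, by simpa using hk₀⟩
    simp only [Finset.mem_filter, Finset.mem_univ, true_and] at hk hmin
    set t := p k / -d k with ht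
    have ht0 : 0 ≤ t := div_nonneg (hp.1 k) (by linarith)
    have hp' : p + t • d ∈ feasibleSet A b := by
      refine hmove t fun i => ?_
      rcases lt_or_ge (d i) 0 with hi | hi
      · have := hmin i hi
        rw [le_div_iff₀ (by linarith)] at this
        linarith
      · exact add_nonneg (hp.1 i) (mul_nonneg ht0 hi)
    have hpk : p k ≠ 0 := fun h => hk.ne (hdp k h)
    have hlt : (Finset.univ.filter fun i => (p + t • d) i ≠ 0).card
        < (Finset.univ.filter fun i => p i ≠ 0).card := by
      refine Finset.card_lt_card (Finset.ssubset_iff_of_subset ?_ |>.2 ⟨k, by simpa using hpk, ?_⟩)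
      · intro i
        simp only [Finset.mem_filter, Finset.mem_univ, true_and, Pi.add_apply, Pi.smul_apply]
        intro h h'
        exact h (by simp [h', hdp i h'])
      · simp only [Finset.mem_filter, Finset.mem_univ, true_and, Pi.add_apply, Pi.smul_apply,
          not_not, smul_eq_mul, ht]
        field_simp [hk.ne]
        ring
    obtain ⟨B, hB, hle⟩ := ih _ hp' (by omega)
    refine ⟨B, hB, hle.trans ?_⟩
    rw [dotProduct_add, dotProduct_smul, smul_eq_mul]
    nlinarith [mul_nonneg ht0 (neg_nonneg.2 hdc)]

/-- The value of the linear program is attained at any optimal basis. -/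
theorem lpMin_eq_basisValue {A : Matrix (Fin J) (Fin K) ℝ} (hA : A.rank = J)
    {b : Fin J → ℝ} (hbd : Bornology.IsBounded (feasibleSet A b)) {c : Fin K → ℝ}
    {B : Basis J K} (hB : B ∈ optimalBases A b c) : lpMin A b c = basisValue A b c B := by
  refine IsLeast.csInf_eq ⟨⟨_, basisInv_mulVec_mem_feasibleSet hB.1, rfl⟩, ?_⟩
  rintro _ ⟨p, hp, rfl⟩
  obtain ⟨B', hB', h⟩ := exists_feasibleBasis_le hA hbd c _ p hp le_rfl
  exact (hB.2 B' hB').trans h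

/-! ### The objective value is a bounded bilinear form -/

theorem basisValue_add_right (A : Matrix (Fin J) (Fin K) ℝ) (b : Fin J → ℝ) (c c' : Fin K → ℝ)
    (B : Basis J K) : basisValue A b (c + c') B = basisValue A b c B + basisValue A b c' B := by
  simp [basisValue, add_dotProduct]

theorem basisValue_sub_right (A : Matrix (Fin J) (Fin K) ℝ) (b : Fin J → ℝ) (c c' : Fin K → ℝ)
    (B : Basis J K) : basisValue A b (c - c') B = basisValue A b c B - basisValue A b c' B := by
  simp [basisValue, sub_dotProduct]

theorem basisValue_add_left (A : Matrix (Fin J) (Fin K) ℝ) (b b' : Fin J → ℝ) (c : Fin K → ℝ)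
    (B : Basis J K) : basisValue A (b + b') c B = basisValue A b c B + basisValue A b' c B := by
  simp [basisValue, Matrix.mulVec_add, dotProduct_add]

theorem basisValue_sub_left (A : Matrix (Fin J) (Fin K) ℝ) (b b' : Fin J → ℝ) (c : Fin K → ℝ)
    (B : Basis J K) : basisValue A (b - b') c B = basisValue A b c B - basisValue A b' c B := by
  simp [basisValue, Matrix.mulVec_sub, dotProduct_sub]

theorem basisValue_eq_sum (A : Matrix (Fin J) (Fin K) ℝ) (b : Fin J → ℝ) (c : Fin K → ℝ)
    (B : Basis J K) : basisValue A b c B = ∑ k, ∑ j, c k * (basisInv A B k j * b j) := by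
  simp only [basisValue, Matrix.mulVec, dotProduct, Finset.mul_sum]

theorem debiasedTerm_eq (A : Matrix (Fin J) (Fin K) ℝ) (B : Basis J K) (b φb : Fin J → ℝ)
    (c φc : Fin K → ℝ) :
    debiasedTerm A B b φb c φc = basisValue A b (c + φc) B + basisValue A φb c B := rfl

theorem varianceTerm_eq (A : Matrix (Fin J) (Fin K) ℝ) (B : Basis J K) (b φb : Fin J → ℝ)
    (c φc : Fin K → ℝ) :
    varianceTerm A B b φb c φc = basisValue A (b + φb) c B + basisValue A b φc B := rfl

/-- A bound for the entries of all the matrices `A_B⁻¹`. -/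
def basisBound (A : Matrix (Fin J) (Fin K) ℝ) : ℝ :=
  1 + ∑ B : Basis J K, ∑ k, ∑ j, |basisInv A B k j|

theorem basisBound_pos (A : Matrix (Fin J) (Fin K) ℝ) : 0 < basisBound A :=
  add_pos_of_pos_of_nonneg one_pos <| Finset.sum_nonneg fun _ _ => Finset.sum_nonneg fun _ _ =>
    Finset.sum_nonneg fun _ _ => abs_nonneg _

theorem sum_abs_basisInv_le (A : Matrix (Fin J) (Fin K) ℝ) (B : Basis J K) :
    ∑ k, ∑ j, |basisInv A B k j| ≤ basisBound A :=
  le_add_of_nonneg_of_le zero_le_one <|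
    Finset.single_le_sum (f := fun B => ∑ k, ∑ j, |basisInv A B k j|)
    (fun _ _ => Finset.sum_nonneg fun _ _ => Finset.sum_nonneg fun _ _ => abs_nonneg _)
    (Finset.mem_univ B)

theorem abs_basisValue_le (A : Matrix (Fin J) (Fin K) ℝ) (b : Fin J → ℝ) (c : Fin K → ℝ)
    (B : Basis J K) : |basisValue A b c B| ≤ basisBound A * ‖b‖ * ‖c‖ := by
  rw [basisValue_eq_sum]
  calc |∑ k, ∑ j, c k * (basisInv A B k j * b j)|
      ≤ ∑ k, ∑ j, |c k * (basisInv A B k j * b j)| :=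
        (Finset.abs_sum_le_sum_abs _ _).trans
          (Finset.sum_le_sum fun _ _ => Finset.abs_sum_le_sum_abs _ _)
    _ ≤ ∑ k, ∑ j, |basisInv A B k j| * (‖b‖ * ‖c‖) := by
        refine Finset.sum_le_sum fun k _ => Finset.sum_le_sum fun j _ => ?_
        rw [abs_mul, abs_mul, mul_left_comm, mul_comm |c k|]
        have := norm_le_pi_norm b j
        have := norm_le_pi_norm c k
        simp only [Real.norm_eq_abs] at *
        gcongr
    _ ≤ basisBound A * ‖b‖ * ‖c‖ := by
        simp_rw [← Finset.sum_mul]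
        rw [mul_assoc]
        gcongr
        exact sum_abs_basisInv_le A B

/-- The suboptimality at the truth of a basis that is optimal for perturbed vectors: it is at most
of the order of the perturbation, and the basis is optimal unless the gap is at most of that
order. -/
theorem suboptimality_le {A : Matrix (Fin J) (Fin K) ℝ} {b b' : Fin J → ℝ} {c c' : Fin K → ℝ}
    {B B' : Basis J K} (hB : optimalBases A b c = {B})
    (hB' : B' ∈ argminBases (feasibleBases A b) A b' c') {β γ δb δc : ℝ}
    (hb : ‖b‖ ≤ β) (hc : ‖c'‖ ≤ γ) (hb' : ‖b' - b‖ ≤ δb) (hc' : ‖c' - c‖ ≤ δc) :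
    0 ≤ basisValue A b c B' - basisValue A b c B ∧
      basisValue A b c B' - basisValue A b c B ≤ 2 * basisBound A * (β + γ) * (δb + δc) ∧
      (B' = B ∨ 0 < subOptGap A b c ∧ subOptGap A b c ≤ 2 * basisBound A * (β + γ) * (δb + δc)) := by
  have hBm : B ∈ optimalBases A b c := by rw [hB]; rfl
  have hdiff : ∀ D, |basisValue A b' c' D - basisValue A b c D|
      ≤ basisBound A * (β + γ) * (δb + δc) := by
    intro D
    have e : basisValue A b' c' D - basisValue A b c D
        = basisValue A (b' - b) c' D + basisValue A b (c' - c) D := by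
      rw [basisValue_sub_left, basisValue_sub_right]; ring
    have hκ := (basisBound_pos A).le
    have h0b : 0 ≤ β := (norm_nonneg _).trans hb
    have h0c : 0 ≤ γ := (norm_nonneg _).trans hc
    have h0b' : 0 ≤ δb := (norm_nonneg _).trans hb'
    have h0c' : 0 ≤ δc := (norm_nonneg _).trans hc'
    calc _ ≤ |basisValue A (b' - b) c' D| + |basisValue A b (c' - c) D| := e ▸ abs_add_le _ _
      _ ≤ basisBound A * ‖b' - b‖ * ‖c'‖ + basisBound A * ‖b‖ * ‖c' - c‖ :=
        add_le_add (abs_basisValue_le ..) (abs_basisValue_le ..)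
      _ ≤ basisBound A * δb * γ + basisBound A * β * δc := by gcongr
      _ ≤ basisBound A * (β + γ) * (δb + δc) := by
        have h1 := mul_nonneg hκ (mul_nonneg h0b h0b')
        have h2 := mul_nonneg hκ (mul_nonneg h0c h0c')
        nlinarith
  have hle : basisValue A b c B' - basisValue A b c B ≤ 2 * basisBound A * (β + γ) * (δb + δc) := by
    have h1 := abs_le.1 (hdiff B)
    have h2 := abs_le.1 (hdiff B')
    have h3 := hB'.2 B hBm.1
    linarith [h1.2, h2.1]
  refine ⟨sub_nonneg.2 (hBm.2 B' hB'.1), hle, ?_⟩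
  by_cases hne : B' = B
  · exact Or.inl hne
  right
  set S := {d | ∃ D ∈ feasibleBases A b \ optimalBases A b c, ∃ D' ∈ optimalBases A b c,
    d = basisValue A b c D - basisValue A b c D'} with hS
  have hBS : basisValue A b c B' - basisValue A b c B ∈ S :=
    ⟨B', ⟨hB'.1, by rw [hB]; exact hne⟩, B, hBm, rfl⟩
  have hSfin : S.Finite := by
    refine (Set.toFinite (Set.range fun q : Basis J K × Basis J K =>
      basisValue A b c q.1 - basisValue A b c q.2)).subset ?_
    rintro d ⟨D, -, D', -, rfl⟩
    exact ⟨(D, D'), rfl⟩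
  refine ⟨?_, (csInf_le hSfin.bddBelow hBS).trans hle⟩
  obtain ⟨D, hD, D', hD', hd⟩ := Set.Nonempty.csInf_mem ⟨_, hBS⟩ hSfin
  have : subOptGap A b c = basisValue A b c D - basisValue A b c D' := hd
  rw [this, sub_pos]
  by_contra! hcon
  exact hD.2 ⟨hD.1, fun E hE => hcon.trans (hD'.2 E hE)⟩

end LP

section SampleSplitting

variable {𝒪 Ω : Type*} [MeasurableSpace 𝒪] [MeasurableSpace Ω]

/-- Chebyshev's inequality for a normalized and centered sum. -/
theorem measure_abs_centered_sum_ge_le {P : Measure 𝒪} [IsProbabilityMeasure P] {μ : Measure Ω}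
    [IsProbabilityMeasure μ] {O : ℕ → Ω → 𝒪} (hO : ∀ i, Measurable (O i))
    (hO_law : ∀ i, μ.map (O i) = P) (hO_indep : iIndepFun O μ) {h : 𝒪 → ℝ} (hh : Measurable h)
    {η : ℝ} (hη : 0 ≤ η) (hD : ∫⁻ o, ‖h o‖ₑ ^ 2 ∂P ≤ ENNReal.ofReal η) {a : ℝ} (ha : 0 < a)
    (n : ℕ) :
    μ {ω | a ≤ |(√n)⁻¹ * ∑ i ∈ Finset.range n, (h (O i ω) - ∫ o, h o ∂P)|}
      ≤ ENNReal.ofReal (η / a ^ 2) := by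
  have hmem : MemLp h 2 P := by
    refine ⟨hh.aestronglyMeasurable, ?_⟩
    rw [eLpNorm_lt_top_iff_lintegral_rpow_enorm_lt_top (by simp) (by simp)]
    simpa using hD.trans_lt ENNReal.ofReal_lt_top
  have hsq : ∫ o, h o ^ 2 ∂P ≤ η := by
    have e : ∫ o, h o ^ 2 ∂P = (∫⁻ o, ‖h o‖ₑ ^ 2 ∂P).toReal := by
      rw [integral_eq_lintegral_of_nonneg_ae (ae_of_all _ fun _ => sq_nonneg _)
        (by fun_prop)]
      congr 1
      refine lintegral_congr fun o => ?_
      rw [← sq_abs, ENNReal.ofReal_pow (abs_nonneg _), ← Real.enorm_eq_ofReal_abs]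
    rw [e]
    exact ENNReal.toReal_le_of_le_ofReal hη hD
  have hmp : ∀ i, MeasurePreserving (O i) μ P := fun i => ⟨hO i, hO_law i⟩
  have hmemi : ∀ i, MemLp (fun ω => h (O i ω)) 2 μ := fun i => hmem.comp_measurePreserving (hmp i)
  have hint : ∀ i, ∫ ω, h (O i ω) ∂μ = ∫ o, h o ∂P := fun i => by
    rw [← hO_law i, integral_map (hO i).aemeasurable hh.aestronglyMeasurable]
  have hvar : ∀ i, Var[fun ω => h (O i ω); μ] ≤ η := fun i => by
    refine (variance_le_expectation_sq (hmemi i).aestronglyMeasurable).trans ?_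
    have : ∫ ω, h (O i ω) ^ 2 ∂μ = ∫ o, h o ^ 2 ∂P := by
      rw [← hO_law i, integral_map (hO i).aemeasurable (by fun_prop)]
    simpa using this.le.trans hsq
  rcases Nat.eq_zero_or_pos n with rfl | hn
  · have : {ω : Ω | a ≤ |(√((0 : ℕ) : ℝ))⁻¹ * ∑ i ∈ Finset.range 0,
        (h (O i ω) - ∫ o, h o ∂P)|} = ∅ := by
      ext ω; simpa using ha
    rw [this]; simp
  have hn' : (0 : ℝ) < n := by exact_mod_cast hn
  set S : Ω → ℝ := fun ω => ∑ i ∈ Finset.range n, h (O i ω) with hS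
  have hSmem : MemLp S 2 μ := memLp_finsetSum _ fun i _ => hmemi i
  have hSint : ∫ ω, S ω ∂μ = n * ∫ o, h o ∂P := by
    rw [hS, integral_finsetSum _ fun i _ => (hmemi i).integrable (by simp)]
    simp [hint]
  have hSvar : Var[S; μ] ≤ n * η := by
    have e : S = ∑ i ∈ Finset.range n, fun ω => h (O i ω) := by ext ω; simp [hS]
    rw [e, IndepFun.variance_sum (fun i _ => hmemi i) fun i _ j _ hij =>
      (hO_indep.indepFun hij).comp hh hh]
    calc _ ≤ ∑ i ∈ Finset.range n, η := Finset.sum_le_sum fun i _ => hvar i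
      _ = n * η := by simp
  have hset : {ω | a ≤ |(√n)⁻¹ * ∑ i ∈ Finset.range n, (h (O i ω) - ∫ o, h o ∂P)|}
      = {ω | a * √n ≤ |S ω - ∫ ω, S ω ∂μ|} := by
    rw [hSint]
    ext ω
    simp only [Set.mem_ofPred_eq, hS, Finset.sum_sub_distrib, Finset.sum_const,
      Finset.card_range, nsmul_eq_mul, abs_mul, abs_inv, abs_of_nonneg (Real.sqrt_nonneg (n : ℝ))]
    rw [inv_mul_eq_div, le_div_iff₀ (Real.sqrt_pos.2 hn')]
  rw [hset]
  refine (meas_ge_le_variance_div_sq hSmem (by positivity)).trans (ENNReal.ofReal_le_ofReal ?_)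
  rw [mul_pow, Real.sq_sqrt hn'.le, div_le_div_iff₀ (by positivity) (by positivity)]
  nlinarith [mul_le_mul_of_nonneg_right hSvar (sq_nonneg a)]

/-- A bound that holds for each fixed value of a random variable `W` carries over to `W` itself if
`W` is independent of the rest. -/
theorem measure_le_of_indepFun {𝒲 E : Type*} [MeasurableSpace 𝒲] [MeasurableSpace E]
    {μ : Measure Ω} [IsProbabilityMeasure μ] {W : Ω → 𝒲} {Y : Ω → E} (hW : Measurable W)
    (hY : Measurable Y) (hind : IndepFun W Y μ) {s : Set (𝒲 × E)} (hs : MeasurableSet s)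
    {q : ℝ≥0∞} (h : ∀ w, μ {ω | (w, Y ω) ∈ s} ≤ q) : μ {ω | (W ω, Y ω) ∈ s} ≤ q := by
  have h1 : μ {ω | (W ω, Y ω) ∈ s} = μ.map (fun ω => (W ω, Y ω)) s := by
    rw [Measure.map_apply (hW.prodMk hY) hs]; rfl
  have : IsProbabilityMeasure (μ.map W) := Measure.isProbabilityMeasure_map hW.aemeasurable
  rw [h1, (indepFun_iff_map_prod_eq_prod_map_map hW.aemeasurable hY.aemeasurable).1 hind,
    Measure.prod_apply hs]
  calc _ ≤ ∫⁻ _, q ∂μ.map W := by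
        refine lintegral_mono fun w => ?_
        rw [Measure.map_apply hY (measurable_prodMk_left hs)]
        exact h w
    _ = q := by simp

/-- The central limit theorem for the average of an estimated function that is fit on a separate
sample, when the estimated function converges in mean square and its bias is negligible. -/
theorem tendstoInDistribution_sample_splitting {P : Measure 𝒪} [IsProbabilityMeasure P]
    {μ : Measure Ω} [IsProbabilityMeasure μ] {O : ℕ → Ω → 𝒪} (hO : ∀ i, Measurable (O i))
    (hO_law : ∀ i, μ.map (O i) = P) (hO_indep : iIndepFun O μ)
    {𝒲 : ℕ → Type*} [∀ n, MeasurableSpace (𝒲 n)] {W : ∀ n, Ω → 𝒲 n} (hW : ∀ n, Measurable (W n))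
    (hW_indep : ∀ n, IndepFun (W n) (fun ω (i : Fin n) => O i ω) μ)
    {s : ∀ n, 𝒲 n → 𝒪 → ℝ} (hs : ∀ n, Measurable fun q : 𝒲 n × 𝒪 => s n q.1 q.2)
    {T : 𝒪 → ℝ} (hT : MemLp T 2 P) (hV : 0 < Var[T; P])
    (h_l2 : ∀ η : ℝ, 0 < η → Tendsto (fun n =>
      μ {ω | ENNReal.ofReal η < ∫⁻ o, ‖s n (W n ω) o - T o‖ₑ ^ 2 ∂P}) atTop (𝓝 0))
    (h_bias : ∀ η : ℝ, 0 < η → Tendsto (fun n : ℕ =>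
      μ {ω | η < √n * |∫ o, (s n (W n ω) o - T o) ∂P|}) atTop (𝓝 0)) :
    TendstoInDistribution (fun (n : ℕ) ω =>
        √(n : ℝ) * ((1 / n : ℝ) * ∑ i ∈ Finset.range n, s n (W n ω) (O i ω) - ∫ o, T o ∂P)
          / √Var[T; P])
      atTop (id : ℝ → ℝ) (fun _ => μ) (gaussianReal 0 1) := by
  wlog hTm : Measurable T generalizing T
  · have hae := hT.aestronglyMeasurable.ae_eq_mk
    have h1 : ∀ n w, ∫⁻ o, ‖s n w o - hT.aestronglyMeasurable.mk T o‖ₑ ^ 2 ∂P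
        = ∫⁻ o, ‖s n w o - T o‖ₑ ^ 2 ∂P := fun n w => by
      refine lintegral_congr_ae ?_
      filter_upwards [hae] with o ho
      rw [ho]
    have h2 : ∀ n w, ∫ o, (s n w o - hT.aestronglyMeasurable.mk T o) ∂P
        = ∫ o, (s n w o - T o) ∂P := fun n w => by
      refine integral_congr_ae ?_
      filter_upwards [hae] with o ho
      rw [ho]
    have := this (T := hT.aestronglyMeasurable.mk T) ((memLp_congr_ae hae).1 hT)
      (by rwa [← variance_congr hae]) (by simpa only [h1] using h_l2)
      (by simpa only [h2] using h_bias) hT.aestronglyMeasurable.stronglyMeasurable_mk.measurable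
    rwa [← variance_congr hae, ← integral_congr_ae hae] at this
  set v := Var[T; P] with hv
  set θ := ∫ o, T o ∂P with hθ
  have hmp : ∀ i, MeasurePreserving (O i) μ P := fun i => ⟨hO i, hO_law i⟩
  have hvari : Var[fun ω => T (O 0 ω); μ] = v := by
    rw [hv, ← hO_law 0, variance_map hTm.aemeasurable (hO 0).aemeasurable]; rfl
  have hmeani : ∫ ω, T (O 0 ω) ∂μ = θ := by
    rw [hθ, ← hO_law 0, integral_map (hO 0).aemeasurable hTm.aestronglyMeasurable]
  -- the limit of the oracle average
  have hclt : TendstoInDistribution (fun (n : ℕ) ω =>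
      (√v)⁻¹ * ((√n)⁻¹ * (∑ i ∈ Finset.range n, T (O i ω) - n * θ))) atTop (id : ℝ → ℝ)
      (fun _ => μ) (gaussianReal 0 1) := by
    have hlaw : HasLaw (fun x : ℝ => √v * x) (gaussianReal 0 v.toNNReal) (gaussianReal 0 1) := by
      refine ⟨by fun_prop, ?_⟩
      rw [gaussianReal_map_const_mul]
      congr 1
      · simp
      · ext
        simp [Real.sq_sqrt hV.le, hV.le]
    have := tendstoInDistribution_inv_sqrt_mul_sum_sub (X := fun i ω => T (O i ω)) (P := μ)
      (by rw [hvari]; exact hlaw) (hT.comp_measurePreserving (hmp 0))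
      (hO_indep.comp (fun _ => T) fun _ => hTm)
      (fun i => IdentDistrib.comp ⟨(hO i).aemeasurable, (hO 0).aemeasurable,
        by rw [hO_law, hO_law]⟩ hTm)
    have := this.continuous_comp (g := fun x => (√v)⁻¹ * x) (by fun_prop)
    rw [hmeani] at this
    convert! this using 1
    ext x
    have : √v ≠ 0 := (Real.sqrt_pos.2 hV).ne'
    simp [this]
  -- the remainder
  have hgm : ∀ n, Measurable fun q : 𝒲 n × 𝒪 => s n q.1 q.2 - T q.2 := fun n =>
    (hs n).sub (hTm.comp measurable_snd)
  have hDm : ∀ n, Measurable fun w : 𝒲 n => ∫⁻ o, ‖s n w o - T o‖ₑ ^ 2 ∂P := fun n =>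
    Measurable.lintegral_prod_right' (f := fun q : 𝒲 n × 𝒪 => ‖s n q.1 q.2 - T q.2‖ₑ ^ 2)
      ((hgm n).enorm.pow_const 2)
  have hmm : ∀ n, Measurable fun w : 𝒲 n => ∫ o, (s n w o - T o) ∂P := fun n =>
    ((hgm n).stronglyMeasurable.integral_prod_right' (ν := P)).measurable
  have hrem : TendstoInMeasure μ ((fun (n : ℕ) ω => √(n : ℝ) *
      ((1 / n : ℝ) * ∑ i ∈ Finset.range n, s n (W n ω) (O i ω) - θ) / √v) -
      fun (n : ℕ) ω => (√v)⁻¹ * ((√n)⁻¹ * (∑ i ∈ Finset.range n, T (O i ω) - n * θ)))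
      atTop 0 := by
    rw [tendstoInMeasure_iff_norm]
    intro ε hε
    set a := ε * √v / 2 with ha
    have hsv : 0 < √v := Real.sqrt_pos.2 hV
    have ha0 : 0 < a := by positivity
    rw [ENNReal.tendsto_nhds_zero]
    intro q hq
    obtain ⟨q', hq'0, hq'⟩ : ∃ q' : ℝ, 0 < q' ∧ ENNReal.ofReal q' ≤ q / 3 := by
      rcases eq_or_ne (q / 3) ∞ with h | h
      · exact ⟨1, one_pos, by simp [h]⟩
      · refine ⟨(q / 3).toReal, ENNReal.toReal_pos ?_ h, ENNReal.ofReal_toReal_le⟩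
        simpa using hq.ne'
    set η := q' * a ^ 2 with hη
    have hη0 : 0 < η := by positivity
    have hq3 : 0 < q / 3 := lt_of_lt_of_le (ENNReal.ofReal_pos.2 hq'0) hq'
    filter_upwards [ENNReal.tendsto_nhds_zero.1 (h_l2 η hη0) _ hq3,
      ENNReal.tendsto_nhds_zero.1 (h_bias (a / 2) (by positivity)) _ hq3, eventually_gt_atTop 0]
      with n hn1 hn2 hn
    have hn' : (0 : ℝ) < n := by exact_mod_cast hn
    set E : Set (𝒲 n × (Fin n → 𝒪)) := {z | ∫⁻ o, ‖s n z.1 o - T o‖ₑ ^ 2 ∂P ≤ ENNReal.ofReal η ∧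
      a ≤ |(√n)⁻¹ * ∑ i, ((s n z.1 (z.2 i) - T (z.2 i)) - ∫ o, (s n z.1 o - T o) ∂P)|} with hE
    have hEm : MeasurableSet E := by
      have hsum : Measurable fun z : 𝒲 n × (Fin n → 𝒪) =>
          ∑ i, ((s n z.1 (z.2 i) - T (z.2 i)) - ∫ o, (s n z.1 o - T o) ∂P) :=
        Finset.measurable_fun_sum _ fun i _ => ((hgm n).comp
          (measurable_fst.prodMk ((measurable_pi_apply i).comp measurable_snd))).sub
        ((hmm n).comp measurable_fst)
      exact (measurableSet_le ((hDm n).comp measurable_fst) measurable_const).inter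
        (measurableSet_le measurable_const (hsum.const_mul (√n)⁻¹).norm)
    have h3 : μ {ω | (W n ω, fun i : Fin n => O i ω) ∈ E} ≤ q / 3 := by
      refine measure_le_of_indepFun (Y := fun ω (i : Fin n) => O i ω) (hW n) 
        (measurable_pi_lambda _ fun i => hO i) (hW_indep n) hEm fun w => ?_
      by_cases hw : ∫⁻ o, ‖s n w o - T o‖ₑ ^ 2 ∂P ≤ ENNReal.ofReal η
      · refine le_trans (measure_mono ?_) ((measure_abs_centered_sum_ge_le hO hO_law hO_indep
          (h := fun o => s n w o - T o) ((hgm n).comp measurable_prodMk_left) hη0.le hw ha0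
          n).trans ?_)
        · intro ω hω
          have := hω.2
          rwa [Fin.sum_univ_eq_sum_range
            (fun i => (s n w (O i ω) - T (O i ω)) - ∫ o, (s n w o - T o) ∂P) n] at this
        · rwa [hη, mul_div_cancel_right₀ _ (by positivity)]
      · have : {ω | (w, fun i : Fin n => O i ω) ∈ E} = ∅ := by
          ext ω
          simp only [hE, Set.mem_ofPred_eq, Set.mem_empty_iff_false, iff_false, not_and]
          exact fun h => absurd h hw
        rw [this]; simp
    have hsub : {ω | ε ≤ ‖((fun (n : ℕ) ω => √(n : ℝ) *
        ((1 / n : ℝ) * ∑ i ∈ Finset.range n, s n (W n ω) (O i ω) - θ) / √v) -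
        fun (n : ℕ) ω => (√v)⁻¹ * ((√n)⁻¹ * (∑ i ∈ Finset.range n, T (O i ω) - n * θ))) n ω
          - (0 : Ω → ℝ) ω‖} ⊆
        ({ω | ENNReal.ofReal η < ∫⁻ o, ‖s n (W n ω) o - T o‖ₑ ^ 2 ∂P} ∪
          {ω | a / 2 < √n * |∫ o, (s n (W n ω) o - T o) ∂P|}) ∪
          {ω | (W n ω, fun i : Fin n => O i ω) ∈ E} := by
      intro ω hω
      by_contra hcon
      simp only [Set.mem_union, Set.mem_ofPred_eq, not_or, not_lt, hE, not_and, not_le] at hcon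
      obtain ⟨⟨hc1, hc2⟩, hc3⟩ := hcon
      have hc3 := hc3 hc1
      rw [Fin.sum_univ_eq_sum_range
        (fun i => (s n (W n ω) (O i ω) - T (O i ω)) - ∫ o, (s n (W n ω) o - T o) ∂P) n] at hc3
      simp only [Set.mem_ofPred_eq, Pi.sub_apply, Pi.zero_apply, sub_zero, Real.norm_eq_abs] at hω
      have hsn : 0 < √(n : ℝ) := Real.sqrt_pos.2 hn'
      have hsq : √(n : ℝ) * √(n : ℝ) = n := Real.mul_self_sqrt hn'.le
      have e : √(n : ℝ) * ((1 / n : ℝ) * ∑ i ∈ Finset.range n, s n (W n ω) (O i ω) - θ) / √v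
          - (√v)⁻¹ * ((√n)⁻¹ * (∑ i ∈ Finset.range n, T (O i ω) - n * θ))
          = (√v)⁻¹ * ((√n)⁻¹ * ∑ i ∈ Finset.range n,
            ((s n (W n ω) (O i ω) - T (O i ω)) - ∫ o, (s n (W n ω) o - T o) ∂P)
            + √n * ∫ o, (s n (W n ω) o - T o) ∂P) := by
        rw [Finset.sum_sub_distrib, Finset.sum_sub_distrib, Finset.sum_const, Finset.card_range,
          nsmul_eq_mul]
        generalize ∑ i ∈ Finset.range n, s n (W n ω) (O i ω) = x
        generalize ∑ i ∈ Finset.range n, T (O i ω) = y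
        generalize ∫ o, (s n (W n ω) o - T o) ∂P = m
        generalize √(n : ℝ) = t at hsn hsq
        rw [← hsq]
        field_simp
        ring
      rw [e, abs_mul, abs_inv, abs_of_pos hsv, inv_mul_eq_div, le_div_iff₀ hsv] at hω
      have h4 := abs_add_le ((√n)⁻¹ * ∑ i ∈ Finset.range n,
        ((s n (W n ω) (O i ω) - T (O i ω)) - ∫ o, (s n (W n ω) o - T o) ∂P))
        (√n * ∫ o, (s n (W n ω) o - T o) ∂P)
      rw [abs_mul √(n : ℝ), abs_of_pos hsn] at h4
      linarith
    calc _ ≤ q / 3 + q / 3 + q / 3 := (measure_mono hsub).trans ((measure_union_le _ _).trans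
          (add_le_add ((measure_union_le _ _).trans (add_le_add hn1 hn2)) h3))
      _ = q := ENNReal.add_thirds q
  refine tendstoInDistribution_of_tendstoInMeasure_sub _ _ hclt hrem fun n => ?_
  have : Measurable fun ω => ∑ i ∈ Finset.range n, s n (W n ω) (O i ω) :=
    Finset.measurable_fun_sum _ fun i _ => (hs n).comp ((hW n).prodMk (hO i))
  exact (((this.const_mul _).sub_const _).const_mul _ |>.div_const _).aemeasurable

end SampleSplitting

/-! ### Measurability -/

section Measurability

variable {J K : ℕ} {α : Type*} [MeasurableSpace α]

theorem measurable_comp_basis {β : Type*} [MeasurableSpace β] {D : α → Basis J K}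
    (hD : ∀ B, MeasurableSet {a | D a = B}) (f : Basis J K → β) : Measurable fun a => f (D a) := by
  let _ : MeasurableSpace (Basis J K) := ⊤
  exact (measurable_from_top (f := f)).comp (measurable_to_countable' hD)

theorem measurable_basisValue (A : Matrix (Fin J) (Fin K) ℝ) {u : α → Fin J → ℝ}
    {v : α → Fin K → ℝ} {D : α → Basis J K} (hu : Measurable u) (hv : Measurable v)
    (hD : ∀ B, MeasurableSet {a | D a = B}) :
    Measurable fun a => basisValue A (u a) (v a) (D a) := by
  simp only [basisValue_eq_sum]
  have h : ∀ k j, Measurable fun a => basisInv A (D a) k j := fun k j =>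
    measurable_comp_basis hD fun B => basisInv A B k j
  have hu' := measurable_pi_iff.1 hu
  have hv' := measurable_pi_iff.1 hv
  exact Finset.measurable_fun_sum _ fun k _ => Finset.measurable_fun_sum _ fun j _ =>
    (hv' k).mul ((h k j).mul (hu' j))

theorem aemeasurable_basisValue (A : Matrix (Fin J) (Fin K) ℝ) {ν : Measure α} {u : α → Fin J → ℝ}
    {v : α → Fin K → ℝ} {D : α → Basis J K} (hu : AEMeasurable u ν) (hv : AEMeasurable v ν)
    (hD : ∀ B, MeasurableSet {a | D a = B}) :
    AEMeasurable (fun a => basisValue A (u a) (v a) (D a)) ν := by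
  refine ⟨_, measurable_basisValue A hu.measurable_mk hv.measurable_mk hD, ?_⟩
  filter_upwards [hu.ae_eq_mk, hv.ae_eq_mk] with a h1 h2
  rw [h1, h2]

theorem measurableSet_optimalBasis_eq {A : Matrix (Fin J) (Fin K) ℝ} {b : α → Fin J → ℝ}
    {c : α → Fin K → ℝ} (hb : Measurable b) (hc : Measurable c) {D : α → Basis J K}
    (hD : ∀ a, optimalBases A (b a) (c a) = {D a}) (B : Basis J K) :
    MeasurableSet {a | D a = B} := by
  have hval : ∀ B', Measurable fun a => basisValue A (b a) (c a) B' := fun B' =>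
    measurable_basisValue A hb hc (D := fun _ => B') fun _ => MeasurableSet.const _
  have hfeas : ∀ B', MeasurableSet {a | B' ∈ feasibleBases A (b a)} := by
    intro B'
    have hk : ∀ k, Measurable fun a => (basisInv A B' *ᵥ b a) k := fun k => by
      have hb' := measurable_pi_iff.1 hb
      simp only [Matrix.mulVec, dotProduct]
      exact Finset.measurable_fun_sum _ fun j _ => (hb' j).const_mul _
    have e : {a | B' ∈ feasibleBases A (b a)} = {_a | IsUnit (basisMatrix A B').det} ∩
        ⋂ k, {a | 0 ≤ (basisInv A B' *ᵥ b a) k} := by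
      ext a
      simp [feasibleBases]
    rw [e]
    exact (MeasurableSet.const _).inter
      (MeasurableSet.iInter fun k => measurableSet_le measurable_const (hk k))
  have h : {a | D a = B} = {a | B ∈ feasibleBases A (b a)} ∩
      ⋂ B', ({a | B' ∈ feasibleBases A (b a)}ᶜ ∪
        {a | basisValue A (b a) (c a) B ≤ basisValue A (b a) (c a) B'}) := by
    ext a
    have : D a = B ↔ B ∈ optimalBases A (b a) (c a) := by
      rw [hD a, Set.mem_singleton_iff, eq_comm]
    simp only [Set.mem_ofPred_eq, this, optimalBases, argminBases, Set.mem_inter_iff,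
      Set.mem_iInter, Set.mem_union, Set.mem_compl_iff, imp_iff_not_or]
  rw [h]
  exact (hfeas B).inter (MeasurableSet.iInter fun B' => (hfeas B').compl.union
    (measurableSet_le (hval B) (hval B')))

end Measurability

/-! ### Auxiliary inequalities -/

theorem norm_toLp_le {ι : Type*} [Fintype ι] {f : ι → ℝ} {M : ℝ} (hM : 0 ≤ M)
    (hf : ∀ i, |f i| ≤ M) : ‖WithLp.toLp 2 f‖ ≤ Fintype.card ι * M := by
  rw [EuclideanSpace.norm_eq, Real.sqrt_le_iff]
  refine ⟨by positivity, ?_⟩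
  calc ∑ i, ‖f i‖ ^ 2 ≤ ∑ _i : ι, M ^ 2 := Finset.sum_le_sum fun i _ =>
        pow_le_pow_left₀ (norm_nonneg _) (hf i) 2
    _ = Fintype.card ι * M ^ 2 := by simp
    _ ≤ (Fintype.card ι * M) ^ 2 := by
      rw [mul_pow]
      gcongr
      exact_mod_cast Nat.le_self_pow two_ne_zero _

theorem lintegral_norm_sq_rpow_le_l2Norm {𝒪 𝒳 ι : Type*} [MeasurableSpace 𝒪] [MeasurableSpace 𝒳]
    [Fintype ι] (P : Measure 𝒪) {X : 𝒪 → 𝒳} (hX : Measurable X) {f : 𝒳 → ι → ℝ}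
    (hf : Measurable f) :
    (∫⁻ o, ‖f (X o)‖ₑ ^ (2 : ℝ) ∂P) ^ (1 / (2 : ℝ)) ≤ l2Norm P X f := by
  refine ENNReal.rpow_le_rpow ?_ (by norm_num)
  have hf' := measurable_pi_iff.1 hf
  have hs : ∑ i, ∫⁻ o, ‖f (X o) i‖ₑ ^ 2 ∂P = ∫⁻ o, ∑ i, ‖f (X o) i‖ₑ ^ 2 ∂P :=
    (lintegral_finsetSum _ fun i _ => (((hf' i).comp hX).enorm.pow_const 2 :)).symm
  rw [hs]
  refine lintegral_mono fun o => ?_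
  rw [ENNReal.rpow_two]
  have h0 : ‖f (X o)‖ ^ 2 ≤ ∑ i, ‖f (X o) i‖ ^ 2 := by
    rw [← Real.le_sqrt (norm_nonneg _) (Finset.sum_nonneg fun _ _ => sq_nonneg _)]
    refine (pi_norm_le_iff_of_nonneg (Real.sqrt_nonneg _)).2 fun i => Real.le_sqrt_of_sq_le ?_
    exact Finset.single_le_sum (f := fun i => ‖f (X o) i‖ ^ 2) (fun _ _ => sq_nonneg _)
      (Finset.mem_univ i)
  simp only [← ofReal_norm, ← ENNReal.ofReal_pow (norm_nonneg _)]
  rw [← ENNReal.ofReal_sum_of_nonneg fun _ _ => sq_nonneg _]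
  exact ENNReal.ofReal_le_ofReal h0

theorem lintegral_norm_mul_norm_le {𝒪 𝒳 ι κ : Type*} [MeasurableSpace 𝒪] [MeasurableSpace 𝒳]
    [Fintype ι] [Fintype κ] (P : Measure 𝒪) {X : 𝒪 → 𝒳} (hX : Measurable X) {u : 𝒳 → ι → ℝ}
    {v : 𝒳 → κ → ℝ} (hu : Measurable u) (hv : Measurable v) :
    ∫⁻ o, ‖u (X o)‖ₑ * ‖v (X o)‖ₑ ∂P ≤ l2Norm P X u * l2Norm P X v := by
  have h := ENNReal.lintegral_mul_le_Lp_mul_Lq P (p := (2 : ℝ)) (q := (2 : ℝ))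
    Real.HolderConjugate.two_two (f := fun o => ‖u (X o)‖ₑ) (g := fun o => ‖v (X o)‖ₑ)
    (hu.comp hX).aestronglyMeasurable.enorm (hv.comp hX).aestronglyMeasurable.enorm
  exact h.trans (mul_le_mul' (lintegral_norm_sq_rpow_le_l2Norm P hX hu)
    (lintegral_norm_sq_rpow_le_l2Norm P hX hv))

theorem integral_comp_mul_eq_zero {𝒪 𝒳 : Type*} [MeasurableSpace 𝒪] [MeasurableSpace 𝒳]
    {P : Measure 𝒪} [IsProbabilityMeasure P] {X : 𝒪 → 𝒳} (hX : Measurable X) {f : 𝒳 → ℝ}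
    (hf : Measurable f) {M : ℝ} (hM : ∀ x, |f x| ≤ M) {Y : 𝒪 → ℝ} (hY : Integrable Y P)
    (hY0 : P[Y | MeasurableSpace.comap X inferInstance] =ᵐ[P] fun _ => 0) :
    ∫ o, f (X o) * Y o ∂P = 0 := by
  have hle : MeasurableSpace.comap X inferInstance ≤ ‹MeasurableSpace 𝒪› := hX.comap_le
  have hfm : StronglyMeasurable[MeasurableSpace.comap X inferInstance] fun o => f (X o) :=
    (hf.comp (comap_measurable X)).stronglyMeasurable
  have h := condExp_stronglyMeasurable_mul_of_bound hle hfm hY M (ae_of_all _ fun o => hM (X o))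
  calc ∫ o, f (X o) * Y o ∂P = ∫ o, ((fun o => f (X o)) * Y) o ∂P := rfl
    _ = ∫ o, P[(fun o => f (X o)) * Y | MeasurableSpace.comap X inferInstance] o ∂P :=
      (integral_condExp hle).symm
    _ = ∫ _, (0 : ℝ) ∂P := by
      refine integral_congr_ae ?_
      filter_upwards [h, hY0] with o h1 h2
      rw [h1, Pi.mul_apply, h2, mul_zero]
    _ = 0 := by simp

section Envelope

variable {J K : ℕ} {𝒪 𝒳 : Type*}

/-- An envelope for the de-biasing functions. -/
def envelope (φb : 𝒪 → Fin J → ℝ) (φc : 𝒪 → Fin K → ℝ) (o : 𝒪) : ℝ := 1 + ‖φb o‖ + ‖φc o‖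

theorem one_le_envelope (φb : 𝒪 → Fin J → ℝ) (φc : 𝒪 → Fin K → ℝ) (o : 𝒪) :
    1 ≤ envelope φb φc o := by
  have := norm_nonneg (φb o)
  have := norm_nonneg (φc o)
  rw [envelope]
  linarith

/-- The event that the sub-optimality gap is positive and at most `t`. -/
def gapEvent (A : Matrix (Fin J) (Fin K) ℝ) (X : 𝒪 → 𝒳) (b : 𝒳 → Fin J → ℝ)
    (c : 𝒳 → Fin K → ℝ) (t : ℝ) : Set 𝒪 :=
  {o | 0 < subOptGap A (b (X o)) (c (X o)) ∧ subOptGap A (b (X o)) (c (X o)) ≤ t}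

theorem measure_gapEvent_le [MeasurableSpace 𝒪] {A : Matrix (Fin J) (Fin K) ℝ} {P : Measure 𝒪}
    [IsFiniteMeasure P] {X : 𝒪 → 𝒳} {b : 𝒳 → Fin J → ℝ} {c : 𝒳 → Fin K → ℝ} {α Cm : ℝ}
    (h_margin : ∀ t : ℝ, 0 < t → P.real (gapEvent A X b c t) ≤ Cm * t ^ α) {t : ℝ} (ht : 0 < t) :
    P (gapEvent A X b c t) ≤ ENNReal.ofReal (Cm * t ^ α) := by
  rw [← ofReal_measureReal]
  exact ENNReal.ofReal_le_ofReal (h_margin t ht)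

end Envelope

section Nuisance

variable {J K : ℕ} {𝒪 𝒳 : Type*} [MeasurableSpace 𝒪] [MeasurableSpace 𝒳]

/-- The true nuisance functions, bounded by `R`, with their de-biasing functions and the unique
optimal basis. -/
structure IsNuisance (A : Matrix (Fin J) (Fin K) ℝ) (P : Measure 𝒪) (X : 𝒪 → 𝒳)
    (b : 𝒳 → Fin J → ℝ) (c : 𝒳 → Fin K → ℝ) (φb : 𝒪 → Fin J → ℝ) (φc : 𝒪 → Fin K → ℝ)
    (Bstar : 𝒳 → Basis J K) (R : ℝ) : Prop where
  measurable_X : Measurable X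
  measurable_b : Measurable b
  measurable_c : Measurable c
  one_le : 1 ≤ R
  norm_b_le : ∀ x, ‖b x‖ ≤ R
  norm_c_le : ∀ x, ‖c x‖ ≤ R
  memLp_φb : MemLp φb 2 P
  memLp_φc : MemLp φc 2 P
  condExp_φb : ∀ j, P[fun o => φb o j | MeasurableSpace.comap X inferInstance] =ᵐ[P] fun _ => 0
  condExp_φc : ∀ k, P[fun o => φc o k | MeasurableSpace.comap X inferInstance] =ᵐ[P] fun _ => 0
  optimalBases_eq : ∀ x, optimalBases A (b x) (c x) = {Bstar x}

/-- Estimates of the nuisance functions with given uniform errors. -/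
structure IsEstimate (A : Matrix (Fin J) (Fin K) ℝ)
    (b : 𝒳 → Fin J → ℝ) (c : 𝒳 → Fin K → ℝ) (φb : 𝒪 → Fin J → ℝ) (φc : 𝒪 → Fin K → ℝ)
    (R : ℝ) (bh : 𝒳 → Fin J → ℝ) (ch : 𝒳 → Fin K → ℝ) (φbh : 𝒪 → Fin J → ℝ)
    (φch : 𝒪 → Fin K → ℝ) (Bh : 𝒳 → Basis J K) (δb δc τ : ℝ) : Prop where
  measurable_bh : Measurable bh
  measurable_ch : Measurable ch
  measurable_φbh : Measurable φbh
  measurable_φch : Measurable φch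
  measurableSet_Bh : ∀ B, MeasurableSet {x | Bh x = B}
  mem_argmin : ∀ x, Bh x ∈ argminBases (feasibleBases A (b x)) A (bh x) (ch x)
  norm_bh_le : ∀ x, ‖bh x‖ ≤ R
  norm_ch_le : ∀ x, ‖ch x‖ ≤ R
  norm_bh_sub_le : ∀ x, ‖bh x - b x‖ ≤ δb
  norm_ch_sub_le : ∀ x, ‖ch x - c x‖ ≤ δc
  norm_φbh_sub_le : ∀ o, ‖φbh o - φb o‖ ≤ τ
  norm_φch_sub_le : ∀ o, ‖φch o - φc o‖ ≤ τ

variable {A : Matrix (Fin J) (Fin K) ℝ} {P : Measure 𝒪} {X : 𝒪 → 𝒳}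
  {b : 𝒳 → Fin J → ℝ} {c : 𝒳 → Fin K → ℝ} {φb : 𝒪 → Fin J → ℝ} {φc : 𝒪 → Fin K → ℝ}
  {Bstar : 𝒳 → Basis J K} {R : ℝ} {bh : 𝒳 → Fin J → ℝ} {ch : 𝒳 → Fin K → ℝ}
  {φbh : 𝒪 → Fin J → ℝ} {φch : 𝒪 → Fin K → ℝ} {Bh : 𝒳 → Basis J K} {δb δc τ : ℝ}

theorem IsNuisance.measurableSet_Bstar (hN : IsNuisance A P X b c φb φc Bstar R)
    (B : Basis J K) : MeasurableSet {o | Bstar (X o) = B} :=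
  hN.measurable_X (measurableSet_optimalBasis_eq hN.measurable_b hN.measurable_c
    hN.optimalBases_eq B)

theorem IsNuisance.aemeasurable_φb (hN : IsNuisance A P X b c φb φc Bstar R) :
    AEMeasurable φb P := hN.memLp_φb.aestronglyMeasurable.aemeasurable

theorem IsNuisance.aemeasurable_φc (hN : IsNuisance A P X b c φb φc Bstar R) :
    AEMeasurable φc P := hN.memLp_φc.aestronglyMeasurable.aemeasurable

theorem varianceTerm_eq_add (A : Matrix (Fin J) (Fin K) ℝ) (B : Basis J K) (b φb : Fin J → ℝ)
    (c φc : Fin K → ℝ) :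
    varianceTerm A B b φb c φc
      = basisValue A b c B + basisValue A φb c B + basisValue A b φc B := by
  rw [varianceTerm_eq, basisValue_add_left]

/-- The error of the estimated influence function, in terms of the envelope. -/
theorem IsEstimate.abs_debiasedTerm_sub_le (hN : IsNuisance A P X b c φb φc Bstar R)
    (hE : IsEstimate A b c φb φc R bh ch φbh φch Bh τ τ τ) (hτ : τ ≤ 1) (o : 𝒪) :
    |debiasedTerm A (Bh (X o)) (bh (X o)) (φbh o) (ch (X o)) (φch o)
        - varianceTerm A (Bstar (X o)) (b (X o)) (φb o) (c (X o)) (φc o)|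
      ≤ 5 * basisBound A * R ^ 2 * envelope φb φc o ∧
    (o ∉ gapEvent A X b c (8 * basisBound A * R * τ) →
      |debiasedTerm A (Bh (X o)) (bh (X o)) (φbh o) (ch (X o)) (φch o)
        - varianceTerm A (Bstar (X o)) (b (X o)) (φb o) (c (X o)) (φc o)|
      ≤ 5 * basisBound A * R ^ 2 * τ * envelope φb φc o) := by
  have hR := hN.one_le
  have hκ := basisBound_pos A
  have hb := hN.norm_b_le (X o)
  have hc := hN.norm_c_le (X o)
  have hbh := hE.norm_bh_le (X o)
  have hch := hE.norm_ch_le (X o)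
  have hdb := hE.norm_bh_sub_le (X o)
  have hdc := hE.norm_ch_sub_le (X o)
  have hpb := hE.norm_φbh_sub_le o
  have hpc := hE.norm_φch_sub_le o
  have hτ0 : 0 ≤ τ := (norm_nonneg _).trans hpb
  have hpb' : ‖φbh o‖ ≤ 1 + ‖φb o‖ := by
    have := norm_le_norm_add_norm_sub' (φbh o) (φb o)
    linarith
  have hpc' : ‖φch o‖ ≤ 1 + ‖φc o‖ := by
    have := norm_le_norm_add_norm_sub' (φch o) (φc o)
    linarith
  set x := X o
  have hy := norm_nonneg (φb o)
  have hz := norm_nonneg (φc o)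
  have hR2 : R ≤ R ^ 2 := by nlinarith
  constructor
  · rw [debiasedTerm_eq, varianceTerm_eq_add, basisValue_add_right]
    have h1 := abs_basisValue_le A (bh x) (ch x) (Bh x)
    have h2 := abs_basisValue_le A (bh x) (φch o) (Bh x)
    have h3 := abs_basisValue_le A (φbh o) (ch x) (Bh x)
    have h4 := abs_basisValue_le A (b x) (c x) (Bstar x)
    have h5 := abs_basisValue_le A (φb o) (c x) (Bstar x)
    have h6 := abs_basisValue_le A (b x) (φc o) (Bstar x)
    have h1' := h1.trans (show _ ≤ basisBound A * R * R by gcongr)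
    have h2' := h2.trans (show _ ≤ basisBound A * R * (1 + ‖φc o‖) by gcongr)
    have h3' := h3.trans (show _ ≤ basisBound A * (1 + ‖φb o‖) * R by gcongr)
    have h4' := h4.trans (show _ ≤ basisBound A * R * R by gcongr)
    have h5' := h5.trans (show _ ≤ basisBound A * ‖φb o‖ * R by gcongr)
    have h6' := h6.trans (show _ ≤ basisBound A * R * ‖φc o‖ by gcongr)
    have hsum : basisBound A * R * R + basisBound A * R * (1 + ‖φc o‖)
        + basisBound A * (1 + ‖φb o‖) * R + basisBound A * R * R + basisBound A * ‖φb o‖ * R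
        + basisBound A * R * ‖φc o‖ ≤ 5 * basisBound A * R ^ 2 * envelope φb φc o := by
      have e : basisBound A * R * R + basisBound A * R * (1 + ‖φc o‖)
          + basisBound A * (1 + ‖φb o‖) * R + basisBound A * R * R + basisBound A * ‖φb o‖ * R
          + basisBound A * R * ‖φc o‖
          = basisBound A * (2 * R ^ 2 + 2 * R + 2 * R * (‖φb o‖ + ‖φc o‖)) := by ring
      have h : 2 * R ^ 2 + 2 * R + 2 * R * (‖φb o‖ + ‖φc o‖)
          ≤ 5 * R ^ 2 * (1 + ‖φb o‖ + ‖φc o‖) := by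
        nlinarith [mul_nonneg (sub_nonneg.2 hR2) (add_nonneg hy hz),
          mul_nonneg (sq_nonneg R) (add_nonneg hy hz)]
      rw [e, envelope]
      exact (mul_le_mul_of_nonneg_left h hκ.le).trans_eq (by ring)
    refine le_trans ?_ hsum
    rw [abs_le] at *
    constructor <;> linarith [h1'.1, h1'.2, h2'.1, h2'.2, h3'.1, h3'.2, h4'.1,
      h4'.2, h5'.1, h5'.2, h6'.1, h6'.2]
  · intro hgap
    have hBeq : Bh x = Bstar x := by
      rcases (suboptimality_le (hN.optimalBases_eq x) (hE.mem_argmin x) hb hch hdb hdc).2.2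
        with h | h
      · exact h
      · refine absurd ⟨h.1, h.2.trans_eq ?_⟩ hgap
        ring
    rw [hBeq, debiasedTerm_eq, varianceTerm_eq_add]
    set B := Bstar x
    have e : basisValue A (bh x) (ch x + φch o) B + basisValue A (φbh o) (ch x) B
        - (basisValue A (b x) (c x) B + basisValue A (φb o) (c x) B + basisValue A (b x) (φc o) B)
        = basisValue A (bh x - b x) (ch x + φch o) B + basisValue A (b x) (ch x - c x) B
          + basisValue A (b x) (φch o - φc o) B + basisValue A (φbh o - φb o) (ch x) B
          + basisValue A (φb o) (ch x - c x) B := by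
      simp only [basisValue_sub_left, basisValue_sub_right, basisValue_add_right]
      ring
    rw [e]
    have h1 := abs_basisValue_le A (bh x - b x) (ch x + φch o) B
    have h2 := abs_basisValue_le A (b x) (ch x - c x) B
    have h3 := abs_basisValue_le A (b x) (φch o - φc o) B
    have h4 := abs_basisValue_le A (φbh o - φb o) (ch x) B
    have h5 := abs_basisValue_le A (φb o) (ch x - c x) B
    have h0 : ‖ch x + φch o‖ ≤ R + (1 + ‖φc o‖) := (norm_add_le _ _).trans (add_le_add hch hpc')
    have h1' := h1.trans (show _ ≤ basisBound A * τ * (R + (1 + ‖φc o‖)) by gcongr)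
    have h2' := h2.trans (show _ ≤ basisBound A * R * τ by gcongr)
    have h3' := h3.trans (show _ ≤ basisBound A * R * τ by gcongr)
    have h4' := h4.trans (show _ ≤ basisBound A * τ * R by gcongr)
    have h5' := h5.trans (show _ ≤ basisBound A * ‖φb o‖ * τ by gcongr)
    have hsum : basisBound A * τ * (R + (1 + ‖φc o‖)) + basisBound A * R * τ
        + basisBound A * R * τ + basisBound A * τ * R + basisBound A * ‖φb o‖ * τ
        ≤ 5 * basisBound A * R ^ 2 * τ * envelope φb φc o := by
      have e : basisBound A * τ * (R + (1 + ‖φc o‖)) + basisBound A * R * τ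
          + basisBound A * R * τ + basisBound A * τ * R + basisBound A * ‖φb o‖ * τ
          = basisBound A * τ * (4 * R + 1 + (‖φb o‖ + ‖φc o‖)) := by ring
      have h : 4 * R + 1 + (‖φb o‖ + ‖φc o‖) ≤ 5 * R ^ 2 * (1 + ‖φb o‖ + ‖φc o‖) := by
        nlinarith [mul_nonneg (sub_nonneg.2 hR2) (add_nonneg hy hz),
          mul_nonneg (sub_nonneg.2 hR) (add_nonneg hy hz)]
      rw [e, envelope]
      exact (mul_le_mul_of_nonneg_left h (by positivity)).trans_eq (by ring)
    refine le_trans ?_ hsum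
    rw [abs_le] at *
    constructor <;> linarith [h1'.1, h1'.2, h2'.1, h2'.2, h3'.1, h3'.2, h4'.1, h4'.2, h5'.1, h5'.2]

variable [IsProbabilityMeasure P]

theorem IsNuisance.memLp_envelope (hN : IsNuisance A P X b c φb φc Bstar R) :
    MemLp (envelope φb φc) 2 P :=
  ((memLp_const (1 : ℝ)).add hN.memLp_φb.norm).add hN.memLp_φc.norm

/-- The objective value of measurable vectors dominated by the envelope is square integrable. -/
theorem IsNuisance.memLp_basisValue (hN : IsNuisance A P X b c φb φc Bstar R)
    {u : 𝒪 → Fin J → ℝ} {v : 𝒪 → Fin K → ℝ} {D : 𝒪 → Basis J K} (hu : AEMeasurable u P)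
    (hv : AEMeasurable v P) (hD : ∀ B, MeasurableSet {o | D o = B}) {M N L : ℝ}
    (h : ∀ o, ‖u o‖ * ‖v o‖ ≤ M + N * ‖φb o‖ + L * ‖φc o‖) :
    MemLp (fun o => basisValue A (u o) (v o) (D o)) 2 P := by
  have h1 : MemLp (fun o => M + N * ‖φb o‖ + L * ‖φc o‖) 2 P :=
    ((memLp_const M).add (hN.memLp_φb.norm.const_mul N)).add (hN.memLp_φc.norm.const_mul L)
  refine (h1.const_mul (basisBound A)).of_le
    (aemeasurable_basisValue A hu hv hD).aestronglyMeasurable (ae_of_all _ fun o => ?_)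
  rw [Real.norm_eq_abs]
  refine (abs_basisValue_le ..).trans (le_trans ?_ (Real.le_norm_self _))
  rw [mul_assoc]
  exact mul_le_mul_of_nonneg_left (h o) (basisBound_pos A).le

theorem IsNuisance.memLp_value (hN : IsNuisance A P X b c φb φc Bstar R) :
    MemLp (fun o => basisValue A (b (X o)) (c (X o)) (Bstar (X o))) 2 P := by
  refine hN.memLp_basisValue (hN.measurable_b.comp hN.measurable_X).aemeasurable
    (hN.measurable_c.comp hN.measurable_X).aemeasurable hN.measurableSet_Bstar
    (M := R * R) (N := 0) (L := 0) fun o => ?_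
  have h1 := hN.norm_b_le (X o)
  have h2 := hN.norm_c_le (X o)
  have := hN.one_le
  simp only [zero_mul, add_zero]
  gcongr

theorem IsNuisance.memLp_value_φb (hN : IsNuisance A P X b c φb φc Bstar R) :
    MemLp (fun o => basisValue A (φb o) (c (X o)) (Bstar (X o))) 2 P := by
  refine hN.memLp_basisValue hN.aemeasurable_φb
    (hN.measurable_c.comp hN.measurable_X).aemeasurable hN.measurableSet_Bstar
    (M := 0) (N := R) (L := 0) fun o => ?_
  have h2 := hN.norm_c_le (X o)
  simp only [zero_mul, add_zero, zero_add]
  rw [mul_comm]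
  gcongr

theorem IsNuisance.memLp_value_φc (hN : IsNuisance A P X b c φb φc Bstar R) :
    MemLp (fun o => basisValue A (b (X o)) (φc o) (Bstar (X o))) 2 P := by
  refine hN.memLp_basisValue (hN.measurable_b.comp hN.measurable_X).aemeasurable
    hN.aemeasurable_φc hN.measurableSet_Bstar (M := 0) (N := 0) (L := R) fun o => ?_
  have h2 := hN.norm_b_le (X o)
  simp only [zero_mul, zero_add]
  gcongr

theorem IsNuisance.memLp_varianceTerm (hN : IsNuisance A P X b c φb φc Bstar R) :
    MemLp (fun o => varianceTerm A (Bstar (X o)) (b (X o)) (φb o) (c (X o)) (φc o)) 2 P := by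
  simp only [varianceTerm_eq_add]
  exact (hN.memLp_value.add hN.memLp_value_φb).add hN.memLp_value_φc

theorem basisValue_eq_dotProduct_left (A : Matrix (Fin J) (Fin K) ℝ) (b : Fin J → ℝ)
    (c : Fin K → ℝ) (B : Basis J K) :
    basisValue A b c B = (fun j => basisValue A (Pi.single j 1) c B) ⬝ᵥ b := by
  rw [basisValue, dotProduct_mulVec]
  congr 1
  ext j
  rw [basisValue, dotProduct_mulVec, dotProduct_single_one]

theorem basisValue_eq_dotProduct_right (A : Matrix (Fin J) (Fin K) ℝ) (b : Fin J → ℝ)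
    (c : Fin K → ℝ) (B : Basis J K) :
    basisValue A b c B = (fun k => basisValue A b (Pi.single k 1) B) ⬝ᵥ c := by
  rw [basisValue, dotProduct_comm]
  congr 1
  ext k
  rw [basisValue, single_one_dotProduct]

theorem norm_single_one_le {n : ℕ} (i : Fin n) : ‖(Pi.single i 1 : Fin n → ℝ)‖ ≤ 1 := by
  refine (pi_norm_le_iff_of_nonneg zero_le_one).2 fun j => ?_
  rw [Pi.single_apply]
  split_ifs <;> simp

theorem abs_basisValue_single_left_le (A : Matrix (Fin J) (Fin K) ℝ) {c : Fin K → ℝ}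
    (hc : ‖c‖ ≤ R) (B : Basis J K) (j : Fin J) :
    |basisValue A (Pi.single j 1) c B| ≤ basisBound A * R := by
  have h1 := norm_single_one_le j
  have h2 := basisBound_pos A
  have h3 := (norm_nonneg c).trans hc
  calc _ ≤ basisBound A * ‖(Pi.single j 1 : Fin J → ℝ)‖ * ‖c‖ := abs_basisValue_le ..
    _ ≤ basisBound A * 1 * R := by gcongr
    _ = basisBound A * R := by ring

theorem abs_basisValue_single_right_le (A : Matrix (Fin J) (Fin K) ℝ) {b : Fin J → ℝ}
    (hb : ‖b‖ ≤ R) (B : Basis J K) (k : Fin K) :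
    |basisValue A b (Pi.single k 1) B| ≤ basisBound A * R := by
  have h1 := norm_single_one_le k
  have h2 := basisBound_pos A
  have h3 := (norm_nonneg b).trans hb
  calc _ ≤ basisBound A * ‖b‖ * ‖(Pi.single k 1 : Fin K → ℝ)‖ := abs_basisValue_le ..
    _ ≤ basisBound A * R * 1 := by gcongr
    _ = basisBound A * R := by ring

/-- The de-biasing functions do not contribute to the mean of the influence function. -/
theorem IsNuisance.integral_varianceTerm (hN : IsNuisance A P X b c φb φc Bstar R) :
    ∫ o, varianceTerm A (Bstar (X o)) (b (X o)) (φb o) (c (X o)) (φc o) ∂P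
      = ∫ o, basisValue A (b (X o)) (c (X o)) (Bstar (X o)) ∂P := by
  have hφb := memLp_pi_iff.1 hN.memLp_φb
  have hφc := memLp_pi_iff.1 hN.memLp_φc
  have hBm : ∀ B, MeasurableSet {x | Bstar x = B} :=
    measurableSet_optimalBasis_eq hN.measurable_b hN.measurable_c hN.optimalBases_eq
  have h1 : ∫ o, basisValue A (φb o) (c (X o)) (Bstar (X o)) ∂P = 0 := by
    simp only [basisValue_eq_dotProduct_left A (φb _), dotProduct]
    have hm : ∀ j, Measurable fun x => basisValue A (Pi.single j 1) (c x) (Bstar x) := fun j =>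
      measurable_basisValue A measurable_const hN.measurable_c hBm
    have hle : ∀ j x, |basisValue A (Pi.single j 1) (c x) (Bstar x)| ≤ basisBound A * R :=
      fun j x => abs_basisValue_single_left_le A (hN.norm_c_le x) _ j
    rw [integral_finsetSum]
    · exact Finset.sum_eq_zero fun j _ => integral_comp_mul_eq_zero hN.measurable_X (hm j) (hle j)
        ((hφb j).integrable (by simp)) (hN.condExp_φb j)
    · exact fun j _ => ((hφb j).integrable (by simp)).bdd_mul
        ((hm j).comp hN.measurable_X).aestronglyMeasurable (ae_of_all _ fun o => hle j (X o))
  have h2 : ∫ o, basisValue A (b (X o)) (φc o) (Bstar (X o)) ∂P = 0 := by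
    simp only [basisValue_eq_dotProduct_right A _ (φc _), dotProduct]
    have hm : ∀ k, Measurable fun x => basisValue A (b x) (Pi.single k 1) (Bstar x) := fun k =>
      measurable_basisValue A hN.measurable_b measurable_const hBm
    have hle : ∀ k x, |basisValue A (b x) (Pi.single k 1) (Bstar x)| ≤ basisBound A * R :=
      fun k x => abs_basisValue_single_right_le A (hN.norm_b_le x) _ k
    rw [integral_finsetSum]
    · exact Finset.sum_eq_zero fun k _ => integral_comp_mul_eq_zero hN.measurable_X (hm k) (hle k)
        ((hφc k).integrable (by simp)) (hN.condExp_φc k)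
    · exact fun k _ => ((hφc k).integrable (by simp)).bdd_mul
        ((hm k).comp hN.measurable_X).aestronglyMeasurable (ae_of_all _ fun o => hle k (X o))
  have i0 := hN.memLp_value.integrable (by simp)
  have i1 := hN.memLp_value_φb.integrable (by simp)
  have i2 := hN.memLp_value_φc.integrable (by simp)
  simp only [varianceTerm_eq_add]
  have i01 : Integrable (fun o => basisValue A (b (X o)) (c (X o)) (Bstar (X o))
      + basisValue A (φb o) (c (X o)) (Bstar (X o))) P := i0.add i1
  rw [integral_add i01 i2, integral_add i0 i1, h1, h2, add_zero, add_zero]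

end Nuisance

theorem supNorm_lt_top {S ι : Type*} {f : S → ι → ℝ} {M : ℝ} (h : ∀ x i, |f x i| ≤ M) :
    supNorm f < ∞ := by
  refine lt_of_le_of_lt (iSup_le fun i => iSup_le fun x => ?_) (ENNReal.ofReal_lt_top (r := M))
  rw [Real.enorm_eq_ofReal_abs]
  exact ENNReal.ofReal_le_ofReal (h x i)

theorem enorm_integral_le_of_debiasedRate {𝒪 𝒳 ι : Type*} [MeasurableSpace 𝒪]
    [MeasurableSpace 𝒳] [Fintype ι] {P : Measure 𝒪} {X : 𝒪 → 𝒳} {g ghat : 𝒳 → ι → ℝ}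
    {φhat : 𝒪 → ι → ℝ} {C : ℝ≥0} {r : ℝ≥0∞}
    (h : DebiasedRate P X g ghat φhat C r) {f : 𝒳 → ι → ℝ} (hf : Measurable f) {M : ℝ}
    (hM : 0 ≤ M) (hfM : ∀ x i, |f x i| ≤ M) :
    ‖∫ o, f (X o) ⬝ᵥ (ghat (X o) + φhat o - g (X o)) ∂P‖ₑ
      ≤ C * ENNReal.ofReal (Fintype.card ι * M) * r := by
  refine (h f hf (supNorm_lt_top hfM)).trans ?_
  gcongr
  refine iSup_le fun x => ?_
  rw [← ofReal_norm]
  exact ENNReal.ofReal_le_ofReal (norm_toLp_le hM (hfM x))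

theorem integral_add_sub_add {α : Type*} [MeasurableSpace α] {ν : Measure α} {f g h k : α → ℝ}
    (hf : Integrable f ν) (hg : Integrable g ν) (hh : Integrable h ν) (hk : Integrable k ν) :
    ∫ a, (f a + g a - h a + k a) ∂ν
      = ∫ a, f a ∂ν + ∫ a, g a ∂ν - ∫ a, h a ∂ν + ∫ a, k a ∂ν := by
  rw [← integral_add hf hg, ← integral_sub (f := fun a => f a + g a) (hf.add hg) hh,
    ← integral_add (f := fun a => f a + g a - h a) ((hf.add hg).sub hh) hk]

section Bounds

variable {J K : ℕ} {𝒪 𝒳 : Type*} [MeasurableSpace 𝒪] [MeasurableSpace 𝒳]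
  {A : Matrix (Fin J) (Fin K) ℝ} {P : Measure 𝒪} [IsProbabilityMeasure P] {X : 𝒪 → 𝒳}
  {b : 𝒳 → Fin J → ℝ} {c : 𝒳 → Fin K → ℝ} {φb : 𝒪 → Fin J → ℝ} {φc : 𝒪 → Fin K → ℝ}
  {Bstar : 𝒳 → Basis J K} {R α Cm : ℝ}

/-- The estimated influence function converges in mean square. -/
theorem IsNuisance.exists_lintegral_sq_le (hN : IsNuisance A P X b c φb φc Bstar R)
    (hα : 0 < α) (h_margin : ∀ t : ℝ, 0 < t → P.real (gapEvent A X b c t) ≤ Cm * t ^ α)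
    {η : ℝ} (hη : 0 < η) :
    ∃ τ : ℝ, 0 < τ ∧ τ ≤ 1 ∧ ∀ bh ch φbh φch Bh,
      IsEstimate A b c φb φc R bh ch φbh φch Bh τ τ τ →
      ∫⁻ o, ‖debiasedTerm A (Bh (X o)) (bh (X o)) (φbh o) (ch (X o)) (φch o)
        - varianceTerm A (Bstar (X o)) (b (X o)) (φb o) (c (X o)) (φc o)‖ₑ ^ 2 ∂P
        ≤ ENNReal.ofReal η := by
  have hR := hN.one_le
  have hκ := basisBound_pos A
  set M := 5 * basisBound A * R ^ 2 with hM
  have hM0 : 0 ≤ M := by positivity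
  set G : 𝒪 → ℝ≥0∞ := fun o => ENNReal.ofReal (envelope φb φc o) ^ 2 with hG
  have hGm : AEMeasurable G P :=
    hN.memLp_envelope.aestronglyMeasurable.aemeasurable.ennreal_ofReal.pow_const 2
  have hGint : ∫⁻ o, G o ∂P ≠ ∞ := by
    have h := hN.memLp_envelope.2
    rw [eLpNorm_lt_top_iff_lintegral_rpow_enorm_lt_top (by simp) (by simp)] at h
    refine (lt_of_le_of_lt (le_of_eq (lintegral_congr fun o => ?_)) h).ne
    rw [hG, Real.enorm_of_nonneg (zero_le_one.trans (one_le_envelope φb φc o))]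
    simp
  have hgap : Tendsto (fun τ : ℝ => P (gapEvent A X b c (8 * basisBound A * R * τ))) (𝓝[>] 0)
      (𝓝 0) := by
    have h1 : Tendsto (fun τ : ℝ => ENNReal.ofReal (Cm * (8 * basisBound A * R * τ) ^ α)) (𝓝[>] 0)
        (𝓝 0) := by
      have hc : Continuous fun τ : ℝ => Cm * (8 * basisBound A * R * τ) ^ α :=
        continuous_const.mul ((continuous_const.mul continuous_id).rpow_const
          fun _ => Or.inr hα.le)
      have := (ENNReal.continuous_ofReal.comp hc).tendsto 0
      simp only [Function.comp_apply, mul_zero, Real.zero_rpow hα.ne', ENNReal.ofReal_zero] at this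
      exact this.mono_left nhdsWithin_le_nhds
    refine tendsto_of_tendsto_of_tendsto_of_le_of_le' tendsto_const_nhds h1
      (Eventually.of_forall fun _ => zero_le) ?_
    filter_upwards [self_mem_nhdsWithin] with τ hτ
    have hτ : 0 < τ := hτ
    exact measure_gapEvent_le h_margin (by positivity)
  have hlim : Tendsto (fun τ : ℝ => ENNReal.ofReal (M ^ 2) * (ENNReal.ofReal (τ ^ 2) * ∫⁻ o, G o ∂P
      + ∫⁻ o in gapEvent A X b c (8 * basisBound A * R * τ), G o ∂P)) (𝓝[>] 0) (𝓝 0) := by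
    have h1 : Tendsto (fun τ : ℝ => ENNReal.ofReal (τ ^ 2)) (𝓝[>] 0) (𝓝 0) := by
      have := (ENNReal.continuous_ofReal.comp (continuous_pow (M := ℝ) 2)).tendsto 0
      simp only [Function.comp_apply, ne_eq, OfNat.ofNat_ne_zero, not_false_eq_true, zero_pow,
        ENNReal.ofReal_zero] at this
      exact this.mono_left nhdsWithin_le_nhds
    have h2 := ENNReal.Tendsto.mul_const h1 (Or.inr hGint)
    have h3 := tendsto_setLIntegral_zero hGint hgap
    have h4 := ENNReal.Tendsto.const_mul (h2.add h3)
      (Or.inr (ENNReal.ofReal_ne_top (r := M ^ 2)))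
    simpa using h4
  have hle : ∀ᶠ τ : ℝ in 𝓝[>] 0, τ ≤ 1 := nhdsWithin_le_nhds (eventually_le_nhds one_pos)
  have hpos : ∀ᶠ τ : ℝ in 𝓝[>] 0, 0 < τ := self_mem_nhdsWithin
  obtain ⟨τ, hτη, hτ1, hτ0⟩ :=
    ((hlim.eventually_lt_const (ENNReal.ofReal_pos.2 hη)).and (hle.and hpos)).exists
  refine ⟨τ, hτ0, hτ1, fun bh ch φbh φch Bh hE => le_trans ?_ hτη.le⟩
  set S := gapEvent A X b c (8 * basisBound A * R * τ)
  calc _ ≤ ∫⁻ o, ENNReal.ofReal (M ^ 2) * (ENNReal.ofReal (τ ^ 2) * G o + S.indicator G o) ∂P := by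
        refine lintegral_mono fun o => ?_
        obtain ⟨h1, h2⟩ := hE.abs_debiasedTerm_sub_le hN hτ1 o
        have he := zero_le_one.trans (one_le_envelope φb φc o)
        simp only [hG]
        by_cases ho : o ∈ S
        · rw [Set.indicator_of_mem ho, Real.enorm_eq_ofReal_abs]
          calc _ ≤ ENNReal.ofReal (M * envelope φb φc o) ^ 2 := by gcongr
            _ = ENNReal.ofReal (M ^ 2) * ENNReal.ofReal (envelope φb φc o) ^ 2 := by
              rw [ENNReal.ofReal_mul hM0, mul_pow, ENNReal.ofReal_pow hM0]
            _ ≤ _ := by gcongr; exact le_add_self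
        · rw [Set.indicator_of_notMem ho, Real.enorm_eq_ofReal_abs, add_zero]
          have h2 := h2 ho
          calc _ ≤ ENNReal.ofReal (M * τ * envelope φb φc o) ^ 2 := by gcongr
            _ = _ := by
              rw [ENNReal.ofReal_mul (by positivity), ENNReal.ofReal_mul hM0, mul_pow, mul_pow,
                ENNReal.ofReal_pow hM0, ENNReal.ofReal_pow hτ0.le, mul_assoc]
    _ ≤ _ := by
        rw [lintegral_const_mul' _ _ ENNReal.ofReal_ne_top,
          lintegral_add_left' (hGm.const_mul _), lintegral_const_mul' _ _ ENNReal.ofReal_ne_top]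
        exact mul_le_mul' le_rfl (add_le_add le_rfl (lintegral_indicator_le _ _))

variable {bh : 𝒳 → Fin J → ℝ} {ch : 𝒳 → Fin K → ℝ} {φbh : 𝒪 → Fin J → ℝ} {φch : 𝒪 → Fin K → ℝ}
  {Bh : 𝒳 → Basis J K} {δb δc τ : ℝ}

/-- The bias of the estimated influence function. -/
theorem IsEstimate.enorm_integral_sub_le (hN : IsNuisance A P X b c φb φc Bstar R)
    (hE : IsEstimate A b c φb φc R bh ch φbh φch Bh δb δc τ) {Cr : ℝ≥0} {r : ℝ≥0∞}
    (hrb : DebiasedRate P X b bh φbh Cr r) (hrc : DebiasedRate P X c ch φch Cr r)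
    (h_margin : ∀ t : ℝ, 0 < t → P.real (gapEvent A X b c t) ≤ Cm * t ^ α)
    (hδb : 0 ≤ δb) (hδc : 0 ≤ δc) :
    ‖∫ o, (debiasedTerm A (Bh (X o)) (bh (X o)) (φbh o) (ch (X o)) (φch o)
        - varianceTerm A (Bstar (X o)) (b (X o)) (φb o) (c (X o)) (φc o)) ∂P‖ₑ
      ≤ Cr * ENNReal.ofReal (K * (basisBound A * R)) * r
        + Cr * ENNReal.ofReal (J * (basisBound A * R)) * r
        + ENNReal.ofReal (basisBound A)
          * (l2Norm P X (fun x => bh x - b x) * l2Norm P X (fun x => ch x - c x))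
        + ENNReal.ofReal (Cm * (4 * basisBound A * R) ^ (1 + α))
          * ENNReal.ofReal ((δb + δc) ^ (1 + α)) := by
  have hR := hN.one_le
  have hκ := basisBound_pos A
  have hX := hN.measurable_X
  have hBo : ∀ B, MeasurableSet {o | Bh (X o) = B} := fun B => hX (hE.measurableSet_Bh B)
  have mb : AEMeasurable (fun o => b (X o)) P := (hN.measurable_b.comp hX).aemeasurable
  have mc : AEMeasurable (fun o => c (X o)) P := (hN.measurable_c.comp hX).aemeasurable
  have mbh : AEMeasurable (fun o => bh (X o)) P := (hE.measurable_bh.comp hX).aemeasurable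
  have mch : AEMeasurable (fun o => ch (X o)) P := (hE.measurable_ch.comp hX).aemeasurable
  have mpb := hE.measurable_φbh.aemeasurable (μ := P)
  have mpc := hE.measurable_φch.aemeasurable (μ := P)
  have i1 : Integrable (fun o => basisValue A (bh (X o)) (ch (X o) + φch o - c (X o)) (Bh (X o)))
      P := by
    refine (hN.memLp_basisValue mbh ((mch.add mpc).sub mc) hBo (M := R * (2 * R + τ)) (N := 0)
      (L := R) fun o => ?_).integrable (by simp)
    have h1 := hE.norm_bh_le (X o)
    have h2 : ‖ch (X o) + φch o - c (X o)‖ ≤ 2 * R + τ + ‖φc o‖ := by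
      have := hE.norm_φch_sub_le o
      have := norm_le_norm_add_norm_sub' (φch o) (φc o)
      have := hE.norm_ch_le (X o)
      have := hN.norm_c_le (X o)
      have := norm_sub_le (ch (X o) + φch o) (c (X o))
      have := norm_add_le (ch (X o)) (φch o)
      linarith
    calc ‖bh (X o)‖ * ‖ch (X o) + φch o - c (X o)‖ ≤ R * (2 * R + τ + ‖φc o‖) := by gcongr
      _ = _ := by ring
  have i2 : Integrable (fun o => basisValue A (bh (X o) + φbh o - b (X o)) (ch (X o)) (Bh (X o)))
      P := by
    refine (hN.memLp_basisValue ((mbh.add mpb).sub mb) mch hBo (M := (2 * R + τ) * R) (N := R)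
      (L := 0) fun o => ?_).integrable (by simp)
    have h1 := hE.norm_ch_le (X o)
    have h2 : ‖bh (X o) + φbh o - b (X o)‖ ≤ 2 * R + τ + ‖φb o‖ := by
      have := hE.norm_φbh_sub_le o
      have := norm_le_norm_add_norm_sub' (φbh o) (φb o)
      have := hE.norm_bh_le (X o)
      have := hN.norm_b_le (X o)
      have := norm_sub_le (bh (X o) + φbh o) (b (X o))
      have := norm_add_le (bh (X o)) (φbh o)
      linarith
    calc ‖bh (X o) + φbh o - b (X o)‖ * ‖ch (X o)‖ ≤ (2 * R + τ + ‖φb o‖) * R :=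
          mul_le_mul h2 h1 (norm_nonneg _) ((norm_nonneg _).trans h2)
      _ = _ := by ring
  have i3 : Integrable (fun o => basisValue A (bh (X o) - b (X o)) (ch (X o) - c (X o))
      (Bh (X o))) P := by
    refine (hN.memLp_basisValue (mbh.sub mb) (mch.sub mc) hBo (M := δb * δc) (N := 0)
      (L := 0) fun o => ?_).integrable (by simp)
    have h1 := hE.norm_bh_sub_le (X o)
    have h2 := hE.norm_ch_sub_le (X o)
    simp only [zero_mul, add_zero]
    exact mul_le_mul h1 h2 (norm_nonneg _) hδb
  have i4 : Integrable (fun o => basisValue A (b (X o)) (c (X o)) (Bh (X o))) P := by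
    refine (hN.memLp_basisValue mb mc hBo (M := R * R) (N := 0) (L := 0)
      fun o => ?_).integrable (by simp)
    have h1 := hN.norm_b_le (X o)
    have h2 := hN.norm_c_le (X o)
    simp only [zero_mul, add_zero]
    exact mul_le_mul h1 h2 (norm_nonneg _) (zero_le_one.trans hR)
  have i5 := hN.memLp_value.integrable (by simp)
  have i6 := hN.memLp_varianceTerm.integrable (by simp)
  have i7 : Integrable (fun o => basisValue A (b (X o)) (c (X o)) (Bh (X o))
      - varianceTerm A (Bstar (X o)) (b (X o)) (φb o) (c (X o)) (φc o)) P := i4.sub i6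
  have hdecomp : ∫ o, (debiasedTerm A (Bh (X o)) (bh (X o)) (φbh o) (ch (X o)) (φch o)
        - varianceTerm A (Bstar (X o)) (b (X o)) (φb o) (c (X o)) (φc o)) ∂P
      = ∫ o, basisValue A (bh (X o)) (ch (X o) + φch o - c (X o)) (Bh (X o)) ∂P
        + ∫ o, basisValue A (bh (X o) + φbh o - b (X o)) (ch (X o)) (Bh (X o)) ∂P
        - ∫ o, basisValue A (bh (X o) - b (X o)) (ch (X o) - c (X o)) (Bh (X o)) ∂P
        + ∫ o, (basisValue A (b (X o)) (c (X o)) (Bh (X o))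
            - basisValue A (b (X o)) (c (X o)) (Bstar (X o))) ∂P := by
    rw [integral_sub i4 i5, ← hN.integral_varianceTerm, ← integral_sub i4 i6,
      ← integral_add_sub_add i1 i2 i3 i7]
    refine integral_congr_ae (ae_of_all _ fun o => ?_)
    simp only [debiasedTerm_eq, basisValue_sub_left, basisValue_sub_right,
      basisValue_add_left, basisValue_add_right]
    ring
  rw [hdecomp]
  have hκR : 0 ≤ basisBound A * R := by positivity
  have b1 : ‖∫ o, basisValue A (bh (X o)) (ch (X o) + φch o - c (X o)) (Bh (X o)) ∂P‖ₑ
      ≤ Cr * ENNReal.ofReal (K * (basisBound A * R)) * r := by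
    have := enorm_integral_le_of_debiasedRate hrc
      (f := fun x k => basisValue A (bh x) (Pi.single k 1) (Bh x))
      (measurable_pi_lambda _ fun k => measurable_basisValue A hE.measurable_bh measurable_const
        hE.measurableSet_Bh) hκR
      fun x k => abs_basisValue_single_right_le A (hE.norm_bh_le x) _ k
    simpa only [← basisValue_eq_dotProduct_right, Fintype.card_fin] using this
  have b2 : ‖∫ o, basisValue A (bh (X o) + φbh o - b (X o)) (ch (X o)) (Bh (X o)) ∂P‖ₑ
      ≤ Cr * ENNReal.ofReal (J * (basisBound A * R)) * r := by
    have := enorm_integral_le_of_debiasedRate hrb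
      (f := fun x j => basisValue A (Pi.single j 1) (ch x) (Bh x))
      (measurable_pi_lambda _ fun j => measurable_basisValue A measurable_const hE.measurable_ch
        hE.measurableSet_Bh) hκR
      fun x j => abs_basisValue_single_left_le A (hE.norm_ch_le x) _ j
    simpa only [← basisValue_eq_dotProduct_left, Fintype.card_fin] using this
  have b3 : ‖∫ o, basisValue A (bh (X o) - b (X o)) (ch (X o) - c (X o)) (Bh (X o)) ∂P‖ₑ
      ≤ ENNReal.ofReal (basisBound A)
        * (l2Norm P X (fun x => bh x - b x) * l2Norm P X (fun x => ch x - c x)) := by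
    refine (enorm_integral_le_lintegral_enorm _).trans ?_
    calc _ ≤ ∫⁻ o, ENNReal.ofReal (basisBound A)
          * (‖bh (X o) - b (X o)‖ₑ * ‖ch (X o) - c (X o)‖ₑ) ∂P := by
          refine lintegral_mono fun o => ?_
          rw [Real.enorm_eq_ofReal_abs, ← ofReal_norm, ← ofReal_norm,
            ← ENNReal.ofReal_mul (norm_nonneg _), ← ENNReal.ofReal_mul hκ.le, ← mul_assoc]
          exact ENNReal.ofReal_le_ofReal (abs_basisValue_le ..)
      _ ≤ _ := by
          rw [lintegral_const_mul' _ _ ENNReal.ofReal_ne_top]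
          gcongr
          exact lintegral_norm_mul_norm_le P hX (hE.measurable_bh.sub hN.measurable_b)
            (hE.measurable_ch.sub hN.measurable_c)
  have b4 : ‖∫ o, (basisValue A (b (X o)) (c (X o)) (Bh (X o))
      - basisValue A (b (X o)) (c (X o)) (Bstar (X o))) ∂P‖ₑ
      ≤ ENNReal.ofReal (Cm * (4 * basisBound A * R) ^ (1 + α))
          * ENNReal.ofReal ((δb + δc) ^ (1 + α)) := by
    refine (enorm_integral_le_lintegral_enorm _).trans ?_
    set t := 4 * basisBound A * R * (δb + δc) with ht
    have ht0 : 0 ≤ t := by positivity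
    calc _ ≤ ∫⁻ o, (gapEvent A X b c t).indicator (fun _ => ENNReal.ofReal t) o ∂P := by
          refine lintegral_mono fun o => ?_
          obtain ⟨h1, h2, h3⟩ := suboptimality_le (hN.optimalBases_eq (X o))
            (hE.mem_argmin (X o)) (hN.norm_b_le _) (hE.norm_ch_le _) (hE.norm_bh_sub_le _)
            (hE.norm_ch_sub_le _)
          have e : 2 * basisBound A * (R + R) * (δb + δc) = t := by rw [ht]; ring
          rw [e] at h2 h3
          rcases h3 with h3 | h3
          · simp [h3]
          · rw [Set.indicator_of_mem (show o ∈ gapEvent A X b c t from h3),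
              Real.enorm_of_nonneg h1]
            exact ENNReal.ofReal_le_ofReal h2
      _ ≤ ENNReal.ofReal t * P (gapEvent A X b c t) := lintegral_indicator_const_le _ _
      _ ≤ _ := by
          rcases ht0.eq_or_lt with h0 | h0
          · simp [← h0]
          · refine (mul_le_mul' le_rfl (measure_gapEvent_le h_margin h0)).trans_eq ?_
            have hCm : 0 ≤ Cm := by
              have := measureReal_nonneg.trans (h_margin 1 one_pos)
              simpa using this
            rw [← ENNReal.ofReal_mul ht0, ← ENNReal.ofReal_mul (by positivity)]
            congr 1
            rw [mul_assoc Cm, ← Real.mul_rpow (by positivity) (by positivity), ← ht,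
              Real.rpow_add h0, Real.rpow_one]
            ring
  refine (enorm_add_le _ _).trans (add_le_add ((enorm_sub_le).trans (add_le_add
    ((enorm_add_le _ _).trans (add_le_add b1 b2)) b3)) b4)

end Bounds

/-! ### Stochastic orders -/

section StochasticOrder

variable {Ω : Type*} [MeasurableSpace Ω] {μ : Measure Ω}

theorem tendsto_measure_zero_mono {s t : ℕ → Set Ω} (ht : Tendsto (fun n => μ (t n)) atTop (𝓝 0))
    (h : ∀ n, s n ⊆ t n) : Tendsto (fun n => μ (s n)) atTop (𝓝 0) :=
  tendsto_of_tendsto_of_tendsto_of_le_of_le tendsto_const_nhds ht (fun _ => zero_le)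
    fun n => measure_mono (h n)

theorem tendsto_measure_zero_union {s t : ℕ → Set Ω}
    (hs : Tendsto (fun n => μ (s n)) atTop (𝓝 0)) (ht : Tendsto (fun n => μ (t n)) atTop (𝓝 0)) :
    Tendsto (fun n => μ (s n ∪ t n)) atTop (𝓝 0) :=
  tendsto_of_tendsto_of_tendsto_of_le_of_le tendsto_const_nhds (by simpa using hs.add ht)
    (fun _ => zero_le) fun n => measure_union_le _ _

/-- Coordinatewise uniform consistency implies uniform consistency in norm. -/
theorem tendsto_measure_norm_sub_gt {ι S : Type*} [Fintype ι] {Y : ℕ → Ω → S → ι → ℝ}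
    {y : S → ι → ℝ}
    (h : ∀ i, IsLittleOp μ (fun n ω => ⨆ x, ‖Y n ω x i - y x i‖ₑ) fun _ => 1)
    {τ : ℝ} (hτ : 0 < τ) :
    Tendsto (fun n => μ {ω | ¬ ∀ x, ‖Y n ω x - y x‖ ≤ τ}) atTop (𝓝 0) := by
  have h1 : Tendsto (fun n => ∑ i, μ {ω | ENNReal.ofReal (τ * 1) < ⨆ x, ‖Y n ω x i - y x i‖ₑ})
      atTop (𝓝 0) := by
    simpa using tendsto_finsetSum Finset.univ fun i _ => h i τ hτ
  refine tendsto_of_tendsto_of_tendsto_of_le_of_le tendsto_const_nhds h1 (fun _ => zero_le)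
    fun n => (measure_mono ?_).trans (measure_iUnion_fintype_le μ _)
  intro ω hω
  by_contra hcon
  simp only [Set.mem_iUnion, Set.mem_ofPred_eq, not_exists, not_lt, mul_one] at hcon
  refine hω fun x => (pi_norm_le_iff_of_nonneg hτ.le).2 fun i => ?_
  have := (le_iSup (fun x => ‖Y n ω x i - y x i‖ₑ) x).trans (hcon i)
  rwa [← ofReal_norm, ENNReal.ofReal_le_ofReal_iff hτ.le] at this

theorem norm_le_toReal_supNorm {S ι : Type*} [Fintype ι] {f : S → ι → ℝ} (hf : supNorm f ≠ ∞)
    (x : S) : ‖f x‖ ≤ (supNorm f).toReal := by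
  refine (pi_norm_le_iff_of_nonneg ENNReal.toReal_nonneg).2 fun i => ?_
  rw [← toReal_enorm]
  exact ENNReal.toReal_mono hf
    ((le_iSup (fun x => ‖f x i‖ₑ) x).trans (le_iSup (fun i => ⨆ x, ‖f x i‖ₑ) i))

end StochasticOrder

end CondLP

end

open CondLP
theorem mainTheorem10
    -- the constraint matrix, of full row rank
    {J K : ℕ} (A : Matrix (Fin J) (Fin K) ℝ) (hA : A.rank = J)
    -- the law `P` of one observation `O`, which includes the covariates `X = X(O)`
    {𝒪 𝒳 : Type*} [MeasurableSpace 𝒪] [MeasurableSpace 𝒳]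
    (P : Measure 𝒪) [IsProbabilityMeasure P] (X : 𝒪 → 𝒳) (hX : Measurable X)
    -- the true constraint and objective vectors
    (b : 𝒳 → Fin J → ℝ) (c : 𝒳 → Fin K → ℝ) (hb : Measurable b) (hc : Measurable c)
    (hb_bdd : supNorm b < ∞) (hc_bdd : supNorm c < ∞)
    (h_nonempty : ∀ x, (feasibleSet A (b x)).Nonempty)
    (h_bounded : ∀ x, Bornology.IsBounded (feasibleSet A (b x)))
    -- the de-biasing functions
    (φb : (𝒳 → Fin J → ℝ) → 𝒪 → Fin J → ℝ) (φc : (𝒳 → Fin K → ℝ) → 𝒪 → Fin K → ℝ)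
    (hφb : IsDebiasing P X b φb) (hφc : IsDebiasing P X c φc)
    -- iid observations, and for each `n` a separate sample that is independent of the first `n`
    {Ω : Type*} [MeasurableSpace Ω] (μ : Measure Ω) [IsProbabilityMeasure μ]
    (O : ℕ → Ω → 𝒪) (hO : ∀ i, Measurable (O i)) (hO_law : ∀ i, μ.map (O i) = P)
    (hO_indep : iIndepFun O μ)
    {𝒲 : ℕ → Type*} [∀ n, MeasurableSpace (𝒲 n)] (W : ∀ n, Ω → 𝒲 n)
    (hW : ∀ n, Measurable (W n))
    (hW_indep : ∀ n, IndepFun (W n) (fun ω (i : Fin n) => O i ω) μ)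
    -- the estimates fit on the separate sample
    (bhat : ∀ n, 𝒲 n → 𝒳 → Fin J → ℝ) (chat : ∀ n, 𝒲 n → 𝒳 → Fin K → ℝ)
    (φbhat : ∀ n, 𝒲 n → 𝒪 → Fin J → ℝ) (φchat : ∀ n, 𝒲 n → 𝒪 → Fin K → ℝ)
    (hbhat : ∀ n, Measurable fun q : 𝒲 n × 𝒳 => bhat n q.1 q.2)
    (hchat : ∀ n, Measurable fun q : 𝒲 n × 𝒳 => chat n q.1 q.2)
    (hφbhat : ∀ n, Measurable fun q : 𝒲 n × 𝒪 => φbhat n q.1 q.2)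
    (hφchat : ∀ n, Measurable fun q : 𝒲 n × 𝒪 => φchat n q.1 q.2)
    -- the estimated optimal basis
    (Bhat : ∀ n, 𝒲 n → 𝒳 → Basis J K)
    (hBhat_meas : ∀ n B, MeasurableSet {q : 𝒲 n × 𝒳 | Bhat n q.1 q.2 = B})
    (hBhat : ∀ n w x,
      Bhat n w x ∈ argminBases (feasibleBases A (b x)) A (bhat n w x) (chat n w x))
    -- uniform consistency of the estimates
    (hbhat_cons : ∀ j, IsLittleOp μ
      (fun n ω => ⨆ x, ‖bhat n (W n ω) x j - b x j‖ₑ) fun _ => 1)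
    (hchat_cons : ∀ k, IsLittleOp μ
      (fun n ω => ⨆ x, ‖chat n (W n ω) x k - c x k‖ₑ) fun _ => 1)
    (hφbhat_cons : ∀ j, IsLittleOp μ
      (fun n ω => ⨆ o, ‖φbhat n (W n ω) o j - φb b o j‖ₑ) fun _ => 1)
    (hφchat_cons : ∀ k, IsLittleOp μ
      (fun n ω => ⨆ o, ‖φchat n (W n ω) o k - φc c o k‖ₑ) fun _ => 1)
    -- the de-biased rate
    (r : ∀ n, 𝒲 n → ℝ≥0∞) (Cr : ℝ≥0)
    (hr_b : ∀ n, ∀ᵐ ω ∂μ,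
      DebiasedRate P X b (bhat n (W n ω)) (φbhat n (W n ω)) Cr (r n (W n ω)))
    (hr_c : ∀ n, ∀ᵐ ω ∂μ,
      DebiasedRate P X c (chat n (W n ω)) (φchat n (W n ω)) Cr (r n (W n ω)))
    -- the margin condition
    (α : ℝ) (hα : 0 < α) (Cm : ℝ)
    (h_margin : ∀ t : ℝ, 0 < t →
      P.real {o | 0 < subOptGap A (b (X o)) (c (X o)) ∧ subOptGap A (b (X o)) (c (X o)) ≤ t}
        ≤ Cm * t ^ α)
    -- the rate conditions
    (h_rate_sup : IsLittleOp μ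
      (fun n ω => (supNorm (fun x => bhat n (W n ω) x - b x)
        + supNorm (fun x => chat n (W n ω) x - c x)) ^ (1 + α))
      fun n => (n : ℝ) ^ (-(1 / 2) : ℝ))
    (h_rate_prod : IsLittleOp μ
      (fun n ω => l2Norm P X (fun x => bhat n (W n ω) x - b x)
        * l2Norm P X (fun x => chat n (W n ω) x - c x))
      fun n => (n : ℝ) ^ (-(1 / 2) : ℝ))
    (h_rate_r : IsLittleOp μ (fun n ω => r n (W n ω)) fun n => (n : ℝ) ^ (-(1 / 2) : ℝ))
    -- the optimal basis is unique
    (Bstar : 𝒳 → Basis J K) (h_unique : ∀ x, optimalBases A (b x) (c x) = {Bstar x})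
    -- the lower bound, its estimator and the asymptotic variance
    (θL : ℝ) (hθL : θL = ∫ o, lpMin A (b (X o)) (c (X o)) ∂P)
    (θhat : ℕ → Ω → ℝ)
    (hθhat : ∀ n ω, θhat n ω = (1 / n : ℝ) * ∑ i ∈ Finset.range n,
      debiasedTerm A (Bhat n (W n ω) (X (O i ω)))
        (bhat n (W n ω) (X (O i ω))) (φbhat n (W n ω) (O i ω))
        (chat n (W n ω) (X (O i ω))) (φchat n (W n ω) (O i ω)))
    (V : ℝ)
    (hV : V = Var[fun o => varianceTerm A (Bstar (X o)) (b (X o)) (φb b o) (c (X o)) (φc c o); P])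
    (hV_pos : 0 < V) :
    TendstoInDistribution (fun (n : ℕ) ω => √(n : ℝ) * (θhat n ω - θL) / √V) atTop
      (id : ℝ → ℝ) (fun _ => μ) (gaussianReal 0 1) := by
  set R := (supNorm b).toReal + (supNorm c).toReal + 1 with hR
  have hb0 : 0 ≤ (supNorm b).toReal := ENNReal.toReal_nonneg
  have hc0 : 0 ≤ (supNorm c).toReal := ENNReal.toReal_nonneg
  have hbR : ∀ x, ‖b x‖ ≤ R - 1 := fun x => by
    have := norm_le_toReal_supNorm hb_bdd.ne x
    linarith
  have hcR : ∀ x, ‖c x‖ ≤ R - 1 := fun x => by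
    have := norm_le_toReal_supNorm hc_bdd.ne x
    linarith
  have hN : IsNuisance A P X b c (φb b) (φc c) Bstar R :=
    { measurable_X := hX
      measurable_b := hb
      measurable_c := hc
      one_le := by linarith
      norm_b_le := fun x => (hbR x).trans (by linarith)
      norm_c_le := fun x => (hcR x).trans (by linarith)
      memLp_φb := memLp_pi_iff.2 hφb.memLp
      memLp_φc := memLp_pi_iff.2 hφc.memLp
      condExp_φb := hφb.condExp_eq_zero
      condExp_φc := hφc.condExp_eq_zero
      optimalBases_eq := h_unique }
  have hE : ∀ n w {δb δc τ : ℝ}, (∀ x, ‖bhat n w x - b x‖ ≤ 1) → (∀ x, ‖chat n w x - c x‖ ≤ 1) →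
      (∀ x, ‖bhat n w x - b x‖ ≤ δb) → (∀ x, ‖chat n w x - c x‖ ≤ δc) →
      (∀ o, ‖φbhat n w o - φb b o‖ ≤ τ) → (∀ o, ‖φchat n w o - φc c o‖ ≤ τ) →
      IsEstimate A b c (φb b) (φc c) R (bhat n w) (chat n w) (φbhat n w) (φchat n w) (Bhat n w)
        δb δc τ := fun n w δb δc τ h1 h2 h3 h4 h5 h6 =>
    { measurable_bh := (hbhat n).comp measurable_prodMk_left
      measurable_ch := (hchat n).comp measurable_prodMk_left
      measurable_φbh := (hφbhat n).comp measurable_prodMk_left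
      measurable_φch := (hφchat n).comp measurable_prodMk_left
      measurableSet_Bh := fun B => measurable_prodMk_left (hBhat_meas n B)
      mem_argmin := hBhat n w
      norm_bh_le := fun x => by
        have := norm_le_norm_add_norm_sub' (bhat n w x) (b x)
        linarith [hbR x, h1 x]
      norm_ch_le := fun x => by
        have := norm_le_norm_add_norm_sub' (chat n w x) (c x)
        linarith [hcR x, h2 x]
      norm_bh_sub_le := h3
      norm_ch_sub_le := h4
      norm_φbh_sub_le := h5
      norm_φch_sub_le := h6 }
  have hcons : ∀ τ : ℝ, 0 < τ → Tendsto (fun n => μ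
      (({ω | ¬ ∀ x, ‖bhat n (W n ω) x - b x‖ ≤ τ} ∪ {ω | ¬ ∀ x, ‖chat n (W n ω) x - c x‖ ≤ τ}) ∪
       ({ω | ¬ ∀ o, ‖φbhat n (W n ω) o - φb b o‖ ≤ τ} ∪
        {ω | ¬ ∀ o, ‖φchat n (W n ω) o - φc c o‖ ≤ τ}))) atTop (𝓝 0) := fun τ hτ =>
    tendsto_measure_zero_union
      (tendsto_measure_zero_union
        (tendsto_measure_norm_sub_gt (Y := fun n ω => bhat n (W n ω)) hbhat_cons hτ)
        (tendsto_measure_norm_sub_gt (Y := fun n ω => chat n (W n ω)) hchat_cons hτ))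
      (tendsto_measure_zero_union
        (tendsto_measure_norm_sub_gt (Y := fun n ω => φbhat n (W n ω)) hφbhat_cons hτ)
        (tendsto_measure_norm_sub_gt (Y := fun n ω => φchat n (W n ω)) hφchat_cons hτ))
  have hθT : θL = ∫ o, varianceTerm A (Bstar (X o)) (b (X o)) (φb b o) (c (X o)) (φc c o) ∂P := by
    rw [hθL, hN.integral_varianceTerm]
    refine integral_congr_ae (ae_of_all _ fun o => ?_)
    exact lpMin_eq_basisValue hA (h_bounded (X o)) (by rw [h_unique]; rfl)
  have hs : ∀ n, Measurable fun q : 𝒲 n × 𝒪 => debiasedTerm A (Bhat n q.1 (X q.2))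
      (bhat n q.1 (X q.2)) (φbhat n q.1 q.2) (chat n q.1 (X q.2)) (φchat n q.1 q.2) := by
    intro n
    have hm : Measurable fun q : 𝒲 n × 𝒪 => (q.1, X q.2) :=
      measurable_fst.prodMk (hX.comp measurable_snd)
    have hB : ∀ B, MeasurableSet {q : 𝒲 n × 𝒪 | Bhat n q.1 (X q.2) = B} := fun B =>
      hm (hBhat_meas n B)
    simp only [debiasedTerm_eq]
    exact (measurable_basisValue A ((hbhat n).comp hm) (((hchat n).comp hm).add (hφchat n)) hB).add
      (measurable_basisValue A (hφbhat n) ((hchat n).comp hm) hB)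
  simp only [hθhat, hθT, hV]
  refine tendstoInDistribution_sample_splitting hO hO_law hO_indep hW hW_indep
    (s := fun n w o => debiasedTerm A (Bhat n w (X o)) (bhat n w (X o)) (φbhat n w o)
      (chat n w (X o)) (φchat n w o)) hs hN.memLp_varianceTerm (hV ▸ hV_pos) ?_ ?_
  · intro η hη
    obtain ⟨τ, hτ0, hτ1, hτ⟩ := hN.exists_lintegral_sq_le hα h_margin hη
    refine tendsto_measure_zero_mono (hcons τ hτ0) fun n ω hω => ?_
    by_contra hcon
    simp only [Set.mem_union, Set.mem_ofPred_eq, not_or, not_not] at hcon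
    obtain ⟨⟨h1, h2⟩, h3, h4⟩ := hcon
    exact absurd hω (not_lt.2 (hτ _ _ _ _ _ (hE n (W n ω) (fun x => (h1 x).trans hτ1)
      (fun x => (h2 x).trans hτ1) h1 h2 h3 h4)))
  · intro η hη
    set C₁ : ℝ := Cr * (K * (basisBound A * R)) + Cr * (J * (basisBound A * R)) with hC₁
    set C₃ : ℝ := Cm * (4 * basisBound A * R) ^ (1 + α) with hC₃
    have hκ := basisBound_pos A
    have hR0 : 0 < R := by linarith
    have hCm : 0 ≤ Cm := by simpa using measureReal_nonneg.trans (h_margin 1 one_pos)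
    have hC₁0 : 0 ≤ C₁ := by positivity
    have hC₃0 : 0 ≤ C₃ := by positivity
    set ε := η / (C₁ + basisBound A + C₃) with hε
    have hε0 : 0 < ε := by positivity
    have hnull : Tendsto (fun n => μ {ω | ¬ (DebiasedRate P X b (bhat n (W n ω)) (φbhat n (W n ω))
        Cr (r n (W n ω)) ∧ DebiasedRate P X c (chat n (W n ω)) (φchat n (W n ω)) Cr
        (r n (W n ω)))}) atTop (𝓝 0) := by
      have : ∀ n, μ {ω | ¬ (DebiasedRate P X b (bhat n (W n ω)) (φbhat n (W n ω))
          Cr (r n (W n ω)) ∧ DebiasedRate P X c (chat n (W n ω)) (φchat n (W n ω)) Cr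
          (r n (W n ω)))} = 0 := fun n => ae_iff.1 ((hr_b n).and (hr_c n))
      simp only [this]
      exact tendsto_const_nhds
    refine tendsto_measure_zero_mono (tendsto_measure_zero_union
      (tendsto_measure_zero_union (hcons 1 one_pos) hnull)
      (tendsto_measure_zero_union (h_rate_r ε hε0)
        (tendsto_measure_zero_union (h_rate_prod ε hε0) (h_rate_sup ε hε0)))) fun n ω hω => ?_
    by_contra hcon
    simp only [Set.mem_union, Set.mem_ofPred_eq, not_or, not_not, not_lt] at hcon
    obtain ⟨⟨⟨⟨h1, h2⟩, h3, h4⟩, hrb, hrc⟩, hrr, hrp, hrs⟩ := hcon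
    have hfb : supNorm (fun x => bhat n (W n ω) x - b x) ≠ ∞ :=
      (supNorm_lt_top fun x j => (norm_le_pi_norm (bhat n (W n ω) x - b x) j).trans (h1 x)).ne
    have hfc : supNorm (fun x => chat n (W n ω) x - c x) ≠ ∞ :=
      (supNorm_lt_top fun x k => (norm_le_pi_norm (chat n (W n ω) x - c x) k).trans (h2 x)).ne
    have hbias := (hE n (W n ω) h1 h2 (norm_le_toReal_supNorm hfb) (norm_le_toReal_supNorm hfc)
      h3 h4).enorm_integral_sub_le hN hrb hrc h_margin ENNReal.toReal_nonneg
      ENNReal.toReal_nonneg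
    set a : ℝ := (n : ℝ) ^ (-(1 / 2) : ℝ) with ha
    have ha0 : 0 ≤ a := by positivity
    rw [← ENNReal.ofReal_rpow_of_nonneg (by positivity) (by positivity),
      ENNReal.ofReal_add ENNReal.toReal_nonneg ENNReal.toReal_nonneg, ENNReal.ofReal_toReal hfb,
      ENNReal.ofReal_toReal hfc] at hbias
    have hbound : |∫ o, (debiasedTerm A (Bhat n (W n ω) (X o)) (bhat n (W n ω) (X o))
        (φbhat n (W n ω) o) (chat n (W n ω) (X o)) (φchat n (W n ω) o)
        - varianceTerm A (Bstar (X o)) (b (X o)) (φb b o) (c (X o)) (φc c o)) ∂P| ≤ η * a := by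
      rw [← ENNReal.ofReal_le_ofReal_iff (by positivity), ← Real.enorm_eq_ofReal_abs]
      refine hbias.trans ?_
      calc _ ≤ Cr * ENNReal.ofReal (K * (basisBound A * R)) * ENNReal.ofReal (ε * a)
            + Cr * ENNReal.ofReal (J * (basisBound A * R)) * ENNReal.ofReal (ε * a)
            + ENNReal.ofReal (basisBound A) * ENNReal.ofReal (ε * a)
            + ENNReal.ofReal C₃ * ENNReal.ofReal (ε * a) := by gcongr
        _ = ENNReal.ofReal ((C₁ + basisBound A + C₃) * (ε * a)) := by
          rw [← ENNReal.ofReal_coe_nnreal, ← ENNReal.ofReal_mul (p := (Cr : ℝ)) (by positivity),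
            ← ENNReal.ofReal_mul (p := (Cr : ℝ)) (by positivity), ← add_mul, ← add_mul, ← add_mul,
            ← ENNReal.ofReal_add (by positivity) (by positivity),
            ← ENNReal.ofReal_add (by positivity) (by positivity),
            ← ENNReal.ofReal_add (by positivity) (by positivity),
            ← ENNReal.ofReal_mul (by positivity)]
        _ = ENNReal.ofReal (η * a) := by
          rw [hε]
          congr 1
          field_simp
    have hna : √(n : ℝ) * a ≤ 1 := by
      rw [ha, Real.sqrt_eq_rpow]
      rcases Nat.eq_zero_or_pos n with h0 | h0
      · simp [h0]
      · rw [← Real.rpow_add (by exact_mod_cast h0)]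
        norm_num
    have hω' : η < √(n : ℝ) * _ := hω
    have := mul_le_mul_of_nonneg_left hbound (Real.sqrt_nonneg (n : ℝ))
    nlinarith
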